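/- **ABS+ polar codes.** Let $n=2^m$, $m\ge 0$, and index vectors from one; bits are added modulo two. An ABS+ polar code is given by a frozen set $\mathcal F\subseteq\{1,\dots,n\}$ and, for $1\le\lambda\le m$, disjoint sets $S_\lambda,A_\lambda\subseteq\{1,\dots,2^\lambda-1\}$ of even numbers such that distinct elements of $I_\lambda=S_\lambda\cup A_\lambda$ differ by at least $4$ (so $I_1=\emptyset$). Let $G_0=(1)$, $F=\begin{pmatrix}1&0\\1&1\end{pmatrix}$, and $G_\lambda=Q_\lambda(G_{\lambda-1}\otimes F)$, where $x\mapsto xQ_\lambda$ swaps $x_i,x_{i+1}$ for every $i\in S_\lambda$ and replaces $x_i$ by $x_i+x_{i+1}$ for every $i\in A_\lambda$. Message vectors are the $u\in\{0,1\}^n$ that vanish on $\mathcal F$; codewords are the vectors $uG_m$. **Channel.** Let $W(y|x)$, $x\in\{0,1\}$, be the transition probabilities (or densities) of a binary-input memoryless channel, let $y=(y_1,\dots,y_n)$ be a received vector with $W(y_\beta|x)>0$ for all $\beta,x$, and put $W(y|u)=\prod_{\beta=1}^n W(y_\beta|(uG_m)_\beta)$ for $u\in\{0,1\}^n$. **Decoder.**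 Put $f_-(a,b)=\operatorname{sgn}(a)\operatorname{sgn}(b)\min\{|a|,|b|\}$ and $f_+(a,b,u)=(-1)^ua+b$. Each path has arrays of bits $B[\lambda,\beta],H[\lambda,\beta]$ and of real numbers $L[\lambda,\beta],R[\lambda,\beta][b],M[\lambda,\beta][a,b]$, decided bits $\hat u_i$, and a metric $\mathrm{PM}$. Initially there is one path, with $\mathrm{PM}=0$ and $L[0,\beta]=\ln\frac{W(y_\beta|0)}{W(y_\beta|1)}$, and $\mathrm{DecodeNode}(0,1)$ is called. A node $(\lambda,i)$ is *right-separated* if $2^{k+1}i\notin I_{\lambda+k+1}$ for all $0\le k<m-\lambda$. $\mathrm{DecodeNode}(m,i)$: every path is continued with $\hat u_i=0$ and, if $i\notin\mathcal F$, also with $\hat u_i=1$; with $\alpha=L[m,1]$, a continuation keeps the metric if $\hat u_i=\frac12(1-\operatorname{sgn}\alpha)$ and otherwise has it increased by $|\alpha|$; $B[m,1]\gets\hat u_i$. With a finite list size, only that many paths of least metric would then be kept; with infinite list size all are kept. $\mathrm{DecodeNode}(\lambda,i)$, $\lambda<m$: let $h=2^{m-\lambda-1}$ and $\beta'=\beta+h$;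 all assignments are made for every path and every $1\le\beta\le h$. For a bit $r$ let $\ell(r)=f_+(L[\lambda,\beta],L[\lambda,\beta'],r)$ and $\rho_b(r)=f_-(R[\lambda,\beta][r+b],R[\lambda,\beta'][b])$. If $2i\in S_{\lambda+1}$ let $\mu_0=\ell+\min(0,\rho_0)-\min(0,\rho_1)$, $\mu_1=\ell-\max(0,\rho_0)+\max(0,\rho_1)$, $\sigma=\rho_1+\max(0,\mu_0)-\max(0,\mu_1)$; if $2i\in A_{\lambda+1}$ let $\mu_0=\ell+\min(0,\rho_0)+\max(0,\rho_1)$, $\mu_1=-\ell+\max(0,\rho_0)+\min(0,\rho_1)$, $\sigma=-\rho_1+\max(0,\mu_0)+\min(0,\mu_1)$; if $2i\notin I_{\lambda+1}$ let $\sigma=\ell$ (all functions of $r$). 1. If $2(i-1)\in I_{\lambda+1}$: $B[\lambda,\beta]\gets H[\lambda,\beta]$. Otherwise: $L[\lambda+1,\beta]\gets R[\lambda+1,\beta][B[\lambda+1,\beta]]$ if $i>1$ and $(\lambda+1,2i-2)$ is not right-separated, and $L[\lambda+1,\beta]\gets f_-(L[\lambda,\beta],L[\lambda,\beta'])$ else;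 if $(\lambda+1,2i-1)$ is not right-separated, $R[\lambda+1,\beta][b]\gets\sigma(b)$ for $b\in\{0,1\}$ and, if moreover $2i\in I_{\lambda+1}$, $M[\lambda,\beta][b,c]\gets\mu_c(b)$ for $b,c\in\{0,1\}$; call $\mathrm{DecodeNode}(\lambda+1,2i-1)$; $B[\lambda,\beta]\gets B[\lambda+1,\beta]$. 2. Let $r_1=B[\lambda,\beta]$. If $(\lambda+1,2i-1)$ is right-separated and $2i\in I_{\lambda+1}$, $M[\lambda,\beta][r_1,c]\gets\mu_c(r_1)$ for $c\in\{0,1\}$. Then $L[\lambda+1,\beta]\gets R[\lambda+1,\beta][B[\lambda+1,\beta]]$ if $(\lambda+1,2i-1)$ is not right-separated, and $L[\lambda+1,\beta]\gets\sigma(r_1)$ else. If $(\lambda+1,2i)$ is not right-separated, $R[\lambda+1,\beta][b]\gets\rho_b(r_1)$ if $2i\notin I_{\lambda+1}$ and $R[\lambda+1,\beta][b]\gets M[\lambda,\beta][r_1,b]$ if $2i\in I_{\lambda+1}$, for $b\in\{0,1\}$. Call $\mathrm{DecodeNode}(\lambda+1,2i)$. 3. If $2i\notin I_{\lambda+1}$: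 with $r_1=B[\lambda,\beta]$, $r_2=B[\lambda+1,\beta]$, set $B[\lambda,\beta]\gets r_1+r_2$, $B[\lambda,\beta']\gets r_2$, and return. 4. If $2i\in I_{\lambda+1}$: $B[\lambda,\beta']\gets B[\lambda+1,\beta]$. With $r_1=B[\lambda,\beta]$, $r_2=B[\lambda,\beta']$: $L[\lambda+1,\beta]\gets M[\lambda,\beta][r_1,r_2]$ and, if $(\lambda+1,2i+1)$ is not right-separated, for $b\in\{0,1\}$, $R[\lambda+1,\beta][b]\gets f_+(R[\lambda,\beta][r_1+b],R[\lambda,\beta'][b],r_2)$ if $2i\in S_{\lambda+1}$ and $R[\lambda+1,\beta][b]\gets f_+(R[\lambda,\beta][r_1+r_2+b],R[\lambda,\beta'][r_2+b],b)$ if $2i\in A_{\lambda+1}$. Call $\mathrm{DecodeNode}(\lambda+1,2i+1)$. With $r_3=B[\lambda+1,\beta]$: if $2i\in S_{\lambda+1}$, $(B[\lambda,\beta],B[\lambda,\beta'],H[\lambda,\beta])\gets(r_1+r_3,\,r_3,\,r_2)$; if $2i\in A_{\lambda+1}$, $(B[\lambda,\beta],B[\lambda,\beta'],H[\lambda,\beta])\gets(r_1+r_2+r_3,\,r_2+r_3,\,r_3)$.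 At the end the decoder returns the codeword estimate $\hat c=(B[0,1],\dots,B[0,n])$ of a path of least metric (ties broken arbitrarily). **Proposition.** With infinite list size this decoder performs maximum-likelihood decoding: an output exists, and a vector $c$ is a possible output if and only if $c$ is a codeword that maximizes $\prod_{\beta}W(y_\beta|c_\beta)$ over all codewords. More precisely, every message vector $\hat u$ occurs as the decided bits of exactly one final path, and no other vector occurs; the codeword estimate of the path with decided bits $\hat u$ is $\hat uG_m$, and its metric is $$\mathrm{PM}=\ln\frac{\max_{u\in\{0,1\}^n}W(y|u)}{W(y|\hat u)}.$$ -/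

import Mathlib

noncomputable section

namespace ABSPlus

/-- The data of an ABS+ polar code of length `n = 2 ^ m`: the frozen set, and for every layer
`l` the positions `i` at which the adjacent bits `i, i + 1` are swapped (`S l`), or at which bit
`i + 1` is added to bit `i` (`A l`). Positions are counted from one. On layer `1` the conditions
force both sets to be empty; values beyond layer `m` are never used. -/
structure Code (m : ℕ) where
  frozen : Finset ℕ
  S : ℕ → Finset ℕ
  A : ℕ → Finset ℕ
  frozen_range : ∀ i ∈ frozen, 1 ≤ i ∧ i ≤ 2 ^ m
  range : ∀ l, 1 ≤ l → l ≤ m → ∀ i ∈ S l ∪ A l, 1 ≤ i ∧ i + 1 ≤ 2 ^ l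
  even : ∀ l, 1 ≤ l → l ≤ m → ∀ i ∈ S l ∪ A l, Even i
  disj : ∀ l, 1 ≤ l → l ≤ m → Disjoint (S l) (A l)
  gap : ∀ l, 1 ≤ l → l ≤ m → ∀ i ∈ S l ∪ A l, ∀ j ∈ S l ∪ A l, i < j → i + 4 ≤ j

/-! ### Encoding -/

/-- The Arikan kernel. -/
def arikanF : Matrix (Fin 2) (Fin 2) (ZMod 2) := !![1, 0; 1, 1]

/-- Right multiplication by this matrix swaps the entries `i` and `i + 1` (counted from one). -/
def swapMatrix (N i : ℕ) : Matrix (Fin N) (Fin N) (ZMod 2) :=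
  Matrix.of fun r c => if (c : ℕ) + 1 = Equiv.swap i (i + 1) ((r : ℕ) + 1) then 1 else 0

/-- Right multiplication by this matrix adds entry `i + 1` to entry `i` (counted from one). -/
def addMatrix (N i : ℕ) : Matrix (Fin N) (Fin N) (ZMod 2) :=
  Matrix.of fun r c => if r = c ∨ ((r : ℕ) + 1 = i + 1 ∧ (c : ℕ) + 1 = i) then 1 else 0

/-- The usual numbering of the row (column) indices of a Kronecker product `G ⊗ F`. -/
def kronEquiv (l : ℕ) : Fin (2 ^ l) × Fin 2 ≃ Fin (2 ^ (l + 1)) :=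
  finProdFinEquiv.trans (finCongr (pow_succ 2 l).symm)

namespace Code

variable {m : ℕ}

/-- All positions of layer `l` at which adjacent bits are transformed. -/
def I (C : Code m) (l : ℕ) : Finset ℕ := C.S l ∪ C.A l

/-- The matrix of the adjacent-bit transforms of layer `l`. -/
def Q (C : Code m) (l : ℕ) : Matrix (Fin (2 ^ l)) (Fin (2 ^ l)) (ZMod 2) :=
  (((C.S l).sort (· ≤ ·)).map (swapMatrix (2 ^ l))).prod *
    (((C.A l).sort (· ≤ ·)).map (addMatrix (2 ^ l))).prod

/-- The polarization matrix. -/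
def G (C : Code m) : (l : ℕ) → Matrix (Fin (2 ^ l)) (Fin (2 ^ l)) (ZMod 2)
  | 0 => 1
  | l + 1 => C.Q (l + 1) *
      Matrix.reindex (kronEquiv l) (kronEquiv l) (Matrix.kronecker (C.G l) arikanF)

/-- Message vectors: zero at all frozen positions. -/
def IsMessage (C : Code m) (u : Fin (2 ^ m) → ZMod 2) : Prop :=
  ∀ j : Fin (2 ^ m), (j : ℕ) + 1 ∈ C.frozen → u j = 0

/-- Encoding of a vector. -/
def encode (C : Code m) (u : Fin (2 ^ m) → ZMod 2) : Fin (2 ^ m) → ZMod 2 :=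
  Matrix.vecMul u (C.G m)

/-- The set of codewords. -/
def codewords (C : Code m) : Set (Fin (2 ^ m) → ZMod 2) :=
  {c | ∃ u, C.IsMessage u ∧ C.encode u = c}

end Code

/-- The likelihood of the channel input `c` given the output `y`, for a memoryless channel whose
transition probabilities (or densities) are `W x y`, for `W (y | x)`. -/
def likelihood {Y : Type*} {n : ℕ} (W : ZMod 2 → Y → ℝ) (y : Fin n → Y) (c : Fin n → ZMod 2) : ℝ :=
  ∏ j, W (c j) (y j)

/-- `c` is a maximum-likelihood codeword for the channel output `y`. -/
def Code.IsMLCodeword {Y : Type*} {m : ℕ} (C : Code m) (W : ZMod 2 → Y → ℝ)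
    (y : Fin (2 ^ m) → Y) (c : Fin (2 ^ m) → ZMod 2) : Prop :=
  c ∈ C.codewords ∧ ∀ c' ∈ C.codewords, likelihood W y c' ≤ likelihood W y c

/-! ### The LLR-domain successive cancellation list decoder -/

/-- `f₋ (a, b) = sgn a * sgn b * min (|a|, |b|)`. -/
def fMinus (a b : ℝ) : ℝ := Real.sign a * Real.sign b * min |a| |b|

/-- `f₊ (a, b, u) = (-1) ^ u * a + b`. -/
def fPlus (a b : ℝ) (u : ZMod 2) : ℝ := (-1) ^ u.val * a + b

/-- A path of the list decoder with its own copy of the decoder's arrays: the decoded message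
bits `u`, the path metric `pm`, and the arrays `B`, `H` (bits), `L` (single-bit LLRs),
`R` (conditional LLRs of the second bit), `M` (intermediate LLRs). The first array index is
the layer, the second one the position, counted from one. -/
structure Path where
  u : ℕ → ZMod 2
  pm : ℝ
  B : ℕ → ℕ → ZMod 2
  H : ℕ → ℕ → ZMod 2
  L : ℕ → ℕ → ℝ
  R : ℕ → ℕ → ZMod 2 → ℝ
  M : ℕ → ℕ → ZMod 2 → ZMod 2 → ℝ

/-- The LLR of `u₃` for the swapped pair, given `u₂ = b`, from the LLRs `a` of the first bit and
`R₀`, `R₁` of the second bit (given that the first one is `0`, `1`) in the unswapped pair. -/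
def swapLLR (a R₀ R₁ : ℝ) (b : ZMod 2) : ℝ :=
  if b = 0 then a + min 0 R₀ - min 0 R₁ else a - max 0 R₀ + max 0 R₁

/-- The analogue of `swapLLR` for the added pair. -/
def addLLR (a R₀ R₁ : ℝ) (b : ZMod 2) : ℝ :=
  if b = 0 then a + min 0 R₀ + max 0 R₁ else -a + max 0 R₀ + min 0 R₁

/-- The LLR of `u₂` for the swapped pair, where `M₀`, `M₁` are the values of `swapLLR`. -/
def swapFirst (R₁ M₀ M₁ : ℝ) : ℝ := R₁ + max 0 M₀ - max 0 M₁

/-- The LLR of `u₂` for the added pair, where `M₀`, `M₁` are the values of `addLLR`. -/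
def addFirst (R₁ M₀ M₁ : ℝ) : ℝ := -R₁ + max 0 M₀ + min 0 M₁

/-- The penalty added to a path metric when a bit with LLR `α` is decided to be `b`. -/
def penalty (α : ℝ) (b : ZMod 2) : ℝ :=
  if (b.val : ℝ) = (1 - Real.sign α) / 2 then 0 else |α|

/-- Elimination of the least reliable paths beyond the list size. -/
def prune (listSize : ℕ∞) (ps : List Path) : List Path :=
  if (ps.length : ℕ∞) ≤ listSize then ps
  else (ps.mergeSort (fun p q => decide (p.pm ≤ q.pm))).take listSize.toNat

namespace Code

variable {m : ℕ}

/-- All edges on the rightmost path from the node `(l, i)` of the recursion tree to a leaf have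
the form `(l', i') → (l' + 1, 2 * i')`. -/
def RightSeparated (C : Code m) (l i : ℕ) : Prop :=
  ∀ k < m - l, 2 ^ (k + 1) * i ∉ C.I (l + k + 1)

instance (C : Code m) (l i : ℕ) : Decidable (C.RightSeparated l i) := by
  unfold RightSeparated; infer_instance

/-!
In the following procedures for the node `(l, i)`, `h = 2 ^ (m - l - 1)` is the length of the
vectors on layer `l + 1`. The loops over `β = 1, …, h` are written as simultaneous assignments,
since the step for `β` only uses entries that no other step changes.
-/

/-- `R₀` and `R₁` in the computations below: LLRs of `u₃`, given `u₁` and `u₂ = b`. -/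
def condLLR (p : Path) (l h β : ℕ) (u₁ b : ZMod 2) : ℝ :=
  fMinus (p.R l β (u₁ + b)) (p.R l (β + h) b)

/-- The quadruple of intermediate values at position `β`, for `2 * i ∈ I (l + 1)`. -/
def interLLR (C : Code m) (p : Path) (l i h β : ℕ) (u₁ b : ZMod 2) : ℝ :=
  let a := fPlus (p.L l β) (p.L l (β + h)) u₁
  if 2 * i ∈ C.S (l + 1) then swapLLR a (condLLR p l h β u₁ 0) (condLLR p l h β u₁ 1) b
  else addLLR a (condLLR p l h β u₁ 0) (condLLR p l h β u₁ 1) b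

/-- The LLR of the bit `u₂` at position `β`, given `u₁`, in the node `(l + 1, 2 * i)`. -/
def secondLLR (C : Code m) (p : Path) (l i h β : ℕ) (u₁ : ZMod 2) : ℝ :=
  if 2 * i ∉ C.I (l + 1) then fPlus (p.L l β) (p.L l (β + h)) u₁
  else if 2 * i ∈ C.S (l + 1) then
    swapFirst (condLLR p l h β u₁ 1) (C.interLLR p l i h β u₁ 0) (C.interLLR p l i h β u₁ 1)
  else
    addFirst (condLLR p l h β u₁ 1) (C.interLLR p l i h β u₁ 0) (C.interLLR p l i h β u₁ 1)

/-- LLRs for the node `(l + 1, 2 * i - 1)`. -/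
def calcLeft (C : Code m) (l i h : ℕ) (p : Path) : Path :=
  { p with
    L := Function.update p.L (l + 1) fun β =>
      if 1 < i ∧ ¬ C.RightSeparated (l + 1) (2 * i - 2) then p.R (l + 1) β (p.B (l + 1) β)
      else fMinus (p.L l β) (p.L l (β + h))
    R := if C.RightSeparated (l + 1) (2 * i - 1) then p.R
      else Function.update p.R (l + 1) fun β b => C.secondLLR p l i h β b
    M := if C.RightSeparated (l + 1) (2 * i - 1) ∨ 2 * i ∉ C.I (l + 1) then p.M
      else Function.update p.M l fun β b b' => C.interLLR p l i h β b b' }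

/-- First half of the middle branch: intermediate values, if they are not yet available. -/
def calcMiddleM (C : Code m) (l i h : ℕ) (p : Path) : Path :=
  { p with
    M := if C.RightSeparated (l + 1) (2 * i - 1) ∧ 2 * i ∈ C.I (l + 1) then
        Function.update p.M l fun β =>
          Function.update (p.M l β) (p.B l β) fun b => C.interLLR p l i h β (p.B l β) b
      else p.M }

/-- Second half of the middle branch: LLRs for the node `(l + 1, 2 * i)`. -/
def calcMiddleLR (C : Code m) (l i h : ℕ) (p : Path) : Path :=
  { p with
    L := Function.update p.L (l + 1) fun β =>
      if ¬ C.RightSeparated (l + 1) (2 * i - 1) then p.R (l + 1) β (p.B (l + 1) β)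
      else C.secondLLR p l i h β (p.B l β)
    R := if C.RightSeparated (l + 1) (2 * i) then p.R
      else Function.update p.R (l + 1) fun β b =>
        if 2 * i ∉ C.I (l + 1) then condLLR p l h β (p.B l β) b else p.M l β (p.B l β) b }

/-- LLRs for the node `(l + 1, 2 * i)`. The bit `u₁` of the transform is stored in `B l β`, the
previously decoded bit of layer `l + 1` in `B (l + 1) β`. -/
def calcMiddle (C : Code m) (l i h : ℕ) (p : Path) : Path :=
  C.calcMiddleLR l i h (C.calcMiddleM l i h p)

/-- LLRs for the node `(l + 1, 2 * i + 1)`, which is visited only if `2 * i ∈ I (l + 1)`. -/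
def calcRight (C : Code m) (l i h : ℕ) (p : Path) : Path :=
  { p with
    L := Function.update p.L (l + 1) fun β => p.M l β (p.B l β) (p.B l (β + h))
    R := if C.RightSeparated (l + 1) (2 * i + 1) then p.R
      else Function.update p.R (l + 1) fun β b =>
        if 2 * i ∈ C.S (l + 1) then
          fPlus (p.R l β (p.B l β + b)) (p.R l (β + h) b) (p.B l (β + h))
        else
          fPlus (p.R l β (p.B l β + p.B l (β + h) + b)) (p.R l (β + h) (p.B l (β + h) + b)) b }

/-- Copy the vector just decoded on layer `l + 1` to the first half of layer `l`. -/
def saveFirst (l h : ℕ) (p : Path) : Path :=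
  { p with B := Function.update p.B l fun β => if β ≤ h then p.B (l + 1) β else p.B l β }

/-- Restore the vector stored in `H` to the first half of layer `l`. -/
def restoreFirst (l h : ℕ) (p : Path) : Path :=
  { p with B := Function.update p.B l fun β => if β ≤ h then p.H l β else p.B l β }

/-- Copy the vector just decoded on layer `l + 1` to the second half of layer `l`. -/
def saveSecond (l h : ℕ) (p : Path) : Path :=
  { p with B := Function.update p.B l fun β => if β ≤ h then p.B l β else p.B (l + 1) (β - h) }

/-- The result `(r₁ + r₂ | r₂)` of a node with two decoded component vectors. -/
def combineTwo (l h : ℕ) (p : Path) : Path :=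
  { p with B := Function.update p.B l fun β =>
      if β ≤ h then p.B l β + p.B (l + 1) β else p.B (l + 1) (β - h) }

/-- The result of a node with three decoded component vectors `r₁, r₂, r₃`: this is
`(r₁ + r₃ | r₃)` for a swap, when `r₂` is kept for the next node of the layer, and
`(r₁ + r₂ + r₃ | r₂ + r₃)` for an addition, when `r₃` is kept. -/
def combineThree (C : Code m) (l i h : ℕ) (p : Path) : Path :=
  if 2 * i ∈ C.S (l + 1) then
    { p with
      B := Function.update p.B l fun β =>
        if β ≤ h then p.B l β + p.B (l + 1) β else p.B (l + 1) (β - h)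
      H := Function.update p.H l fun β => p.B l (β + h) }
  else
    { p with
      B := Function.update p.B l fun β =>
        if β ≤ h then p.B l β + p.B l (β + h) + p.B (l + 1) β
        else p.B l β + p.B (l + 1) (β - h)
      H := Function.update p.H l fun β => p.B (l + 1) β }

/-- Continue a path with the decision `b` on the `i`-th message bit. -/
def extend (m i : ℕ) (p : Path) (b : ZMod 2) : Path :=
  { p with
    u := Function.update p.u i b
    pm := p.pm + penalty (p.L m 1) b
    B := Function.update p.B m (Function.update (p.B m) 1 b) }

/-- The `i`-th phase at the boundary layer: every path is continued with `0` if `i` is frozen, and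
with both `0` and `1` otherwise. -/
def decodeLeaf (C : Code m) (listSize : ℕ∞) (i : ℕ) (ps : List Path) : List Path :=
  prune listSize (ps.flatMap fun p =>
    if i ∈ C.frozen then [extend m i p 0] else [extend m i p 0, extend m i p 1])

/-- Processing of the node `(l, i)`, for all active paths; `d = m - l` is the height of the
node. -/
def decodeNode (C : Code m) (listSize : ℕ∞) : (d l i : ℕ) → List Path → List Path
  | 0, _, i, ps => C.decodeLeaf listSize i ps
  | d + 1, l, i, ps =>
    let h := 2 ^ d
    let ps₁ :=
      if 2 * (i - 1) ∉ C.I (l + 1) then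
        (C.decodeNode listSize d (l + 1) (2 * i - 1) (ps.map (C.calcLeft l i h))).map
          (saveFirst l h)
      else ps.map (restoreFirst l h)
    let ps₂ := C.decodeNode listSize d (l + 1) (2 * i) (ps₁.map (C.calcMiddle l i h))
    if 2 * i ∉ C.I (l + 1) then ps₂.map (combineTwo l h)
    else
      (C.decodeNode listSize d (l + 1) (2 * i + 1)
        ((ps₂.map (saveSecond l h)).map (C.calcRight l i h))).map (C.combineThree l i h)

/-- The single initial path: its metric is zero, and layer `0` holds the channel LLRs. -/
def initialPath {Y : Type*} (W : ZMod 2 → Y → ℝ) (y : Fin (2 ^ m) → Y) : Path where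
  u := 0
  pm := 0
  B := 0
  H := 0
  L := fun l β =>
    if hβ : l = 0 ∧ 1 ≤ β ∧ β ≤ 2 ^ m then
      Real.log (W 0 (y ⟨β - 1, by omega⟩) / W 1 (y ⟨β - 1, by omega⟩))
    else 0
  R := 0
  M := 0

/-- The list of paths after all message bits have been processed. -/
def finalPaths {Y : Type*} (C : Code m) (W : ZMod 2 → Y → ℝ) (y : Fin (2 ^ m) → Y)
    (listSize : ℕ∞) : List Path :=
  C.decodeNode listSize m 0 1 [initialPath W y]

end Code

/-- The decoded message vector of a path. -/
def Path.message (m : ℕ) (p : Path) : Fin (2 ^ m) → ZMod 2 := fun j => p.u (j + 1)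

/-- The codeword estimate of a path, read from layer `0` of its bit array. -/
def Path.codeword (m : ℕ) (p : Path) : Fin (2 ^ m) → ZMod 2 := fun j => p.B 0 (j + 1)

/-- The decoder may return `c`: it is the codeword of a path with the least metric (ties may be
broken in any way). -/
def Code.IsSCLOutput {Y : Type*} {m : ℕ} (C : Code m) (W : ZMod 2 → Y → ℝ)
    (y : Fin (2 ^ m) → Y) (listSize : ℕ∞) (c : Fin (2 ^ m) → ZMod 2) : Prop :=
  ∃ p ∈ C.finalPaths W y listSize,
    (∀ q ∈ C.finalPaths W y listSize, p.pm ≤ q.pm) ∧ p.codeword m = c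

end ABSPlus

end

noncomputable section

namespace ABSPlus

open Function

/-! ### Arithmetic of the max-log LLR rules -/

/-! The decoder's arithmetic, usually read as an approximation of successive cancellation, is exact
in the max-plus sense. Score a vector of any layer by the sum of the log-likelihoods of its codeword
bits (`score`), and let `best N f j x` be the largest score among the vectors that share the first
`j` entries of `x`. Every real number the decoder uses is a difference of two such maxima: the LLR
at position `j` compares the two values of entry `j` for a fixed past, with everything later
maximized out.

If the LLR is `f 0 - f 1`, then the penalty for deciding `b` is `max (f 0) (f 1) - f b`
(`penalty_sub`), that is, the drop of the best attainable score. The metric therefore telescopes: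
after `n` decisions it equals `best` for the empty prefix minus `best` for the decided prefix
(`exit_extend`). After the last decision the second term is the score of the decided vector. Frozen
bits are penalized like all others, which is why the first term ranges over all vectors and not only
over messages.

The update rules compute these differences because of two splittings. A prefix of even length turns
the remaining maximization into two independent ones for the component vectors (`best_pairScore`). A
prefix that cuts no transformed pair is carried by the adjacent-bit transform to a prefix of the
same length (`best_mix`). At a transformed pair one needs a 2 × 2 table of prefix scores, up to a
constant; the difference of its row maxima and the differences within its rows determine it
(`swapLLR_eq`, `addLLR_eq`).

The rest is bookkeeping about one mutable memory per path. Induction on the height of a node shows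
that a path entering it with correct arrays (`Entry`) leaves it with correct bits, metric and data
for its right neighbour (`Exit`). What makes this work is causality: the first `i` entries of layer
`l` depend only on the message bits up to `lastLeaf` (`agreeTo_bit`), so quantities computed earlier
stay correct while later bits are decided. Without pruning, the paths carry every message exactly
once (`map_u_decodeNode`, `nodup_decisions`). All metrics share the same first term, so least metric
means greatest likelihood among codewords. -/

theorem zmod_two_cases (b : ZMod 2) : b = 0 ∨ b = 1 := by
  revert b; decide

theorem zmod_two_one_add_one : (1 : ZMod 2) + 1 = 0 := by decide

/-- With score differences `x`, `y` of two bits, `max 0 (x + y)` belongs to equal bits and `max x y`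
to unequal ones, so the sign-min rule is the exact max-plus LLR of the sum of the two bits. -/
theorem fMinus_eq (x y : ℝ) : fMinus x y = max 0 (x + y) - max x y := by
  unfold fMinus
  rcases lt_trichotomy x 0 with hx | hx | hx <;> rcases lt_trichotomy y 0 with hy | hy | hy <;>
    simp only [Real.sign_of_neg, Real.sign_of_pos, Real.sign_zero, abs_of_neg, abs_of_pos, hx, hy] <;>
    simp only [max_def, min_def] <;> split_ifs <;> linarith

theorem fMinus_sub_sub (a b c d : ℝ) :
    fMinus (a - b) (c - d) = max (a + c) (b + d) - max (b + c) (a + d) := by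
  rw [fMinus_eq]
  simp only [max_def]
  split_ifs <;> linarith

theorem fPlus_zero (a b : ℝ) : fPlus a b 0 = a + b := by simp [fPlus]

theorem fPlus_one (a b : ℝ) : fPlus a b 1 = -a + b := by simp [fPlus, ZMod.val_one]

theorem fPlus_sub_sub (f g : ZMod 2 → ℝ) (u : ZMod 2) :
    fPlus (f 0 - f 1) (g 0 - g 1) u = (f u + g 0) - (f (u + 1) + g 1) := by
  rcases zmod_two_cases u with rfl | rfl
  · rw [fPlus_zero, zero_add]; ring
  · rw [fPlus_one, zmod_two_one_add_one]; ring

theorem penalty_sub (f : ZMod 2 → ℝ) (b : ZMod 2) :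
    penalty (f 0 - f 1) b = max (f 0) (f 1) - f b := by
  unfold penalty
  rcases lt_trichotomy (f 0 - f 1) 0 with h | h | h
  · rw [Real.sign_of_neg h, abs_of_neg h, max_eq_right (by linarith)]
    rcases zmod_two_cases b with rfl | rfl
    · rw [if_neg (by norm_num)]; ring
    · rw [if_pos (by norm_num [ZMod.val_one])]; ring
  -- At a tie the preferred value is `1 / 2`, which no bit attains, but the penalty `|α|` is zero
  -- anyway.
  · rw [h, Real.sign_zero, abs_zero, ite_self]
    have h' : f 1 = f 0 := by linarith
    rcases zmod_two_cases b with rfl | rfl <;> simp [h']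
  · rw [Real.sign_of_pos h, abs_of_pos h, max_eq_left (by linarith)]
    rcases zmod_two_cases b with rfl | rfl
    · rw [if_pos (by norm_num)]; ring
    · rw [if_neg (by norm_num [ZMod.val_one])]

/-- The rule for the swapped pair computes the LLR of the third bit; `E a b` is the best score with
`a`, `b` in the two middle positions of the unswapped quadruple. -/
theorem swapLLR_eq (E : ZMod 2 → ZMod 2 → ℝ) (c : ZMod 2) :
    swapLLR (max (E 0 0) (E 0 1) - max (E 1 0) (E 1 1)) (E 0 0 - E 0 1) (E 1 0 - E 1 1) c =
      E 0 c - E 1 c := by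
  rcases zmod_two_cases c with rfl | rfl <;> simp only [swapLLR] <;>
    simp <;> simp only [max_def, min_def] <;> split_ifs <;> linarith

/-- In each row of `E`, the row maximum plus `min 0 R` is the first entry and the row maximum minus
`max 0 R` is the second, where `R` is the first entry minus the second. Choosing the entries as the
addition requires gives the rule: outer bits `(c, b)` occupy the cell `(c + b, b)`. -/
theorem addLLR_eq (E : ZMod 2 → ZMod 2 → ℝ) (c : ZMod 2) :
    addLLR (max (E 0 0) (E 0 1) - max (E 1 0) (E 1 1)) (E 0 0 - E 0 1) (E 1 0 - E 1 1) c =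
      E c 0 - E (c + 1) 1 := by
  rcases zmod_two_cases c with rfl | rfl <;> simp only [addLLR] <;>
    simp [zmod_two_one_add_one] <;> simp only [max_def, min_def] <;> split_ifs <;> linarith

/-- The identity `y + max 0 (x - y) = max x y`, applied to both columns; `R₁` supplies the offset
between them. -/
theorem swapFirst_eq (E : ZMod 2 → ZMod 2 → ℝ) :
    swapFirst (E 1 0 - E 1 1) (E 0 0 - E 1 0) (E 0 1 - E 1 1) =
      max (E 0 0) (E 1 0) - max (E 0 1) (E 1 1) := by
  simp only [swapFirst, max_def]
  split_ifs <;> linarith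

theorem addFirst_eq (E : ZMod 2 → ZMod 2 → ℝ) :
    addFirst (E 1 0 - E 1 1) (E 0 0 - E 1 1) (E 1 0 - E 0 1) =
      max (E 0 0) (E 1 1) - max (E 1 0) (E 0 1) := by
  simp only [addFirst, max_def, min_def]
  split_ifs <;> linarith

/-! ### Best score of a prefix -/

/-- The vectors `x` and `x'` have the same entries at the positions `1, …, n`. -/
def AgreeTo (n : ℕ) (x x' : ℕ → ZMod 2) : Prop := ∀ k, 1 ≤ k → k ≤ n → x k = x' k

theorem AgreeTo.symm {n : ℕ} {x x' : ℕ → ZMod 2} (h : AgreeTo n x x') : AgreeTo n x' x :=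
  fun k h1 h2 => (h k h1 h2).symm

theorem AgreeTo.trans {n : ℕ} {x x' x'' : ℕ → ZMod 2} (h : AgreeTo n x x')
    (h' : AgreeTo n x' x'') : AgreeTo n x x'' :=
  fun k h1 h2 => (h k h1 h2).trans (h' k h1 h2)

theorem AgreeTo.mono {n n' : ℕ} (hn : n' ≤ n) {x x' : ℕ → ZMod 2} (h : AgreeTo n x x') :
    AgreeTo n' x x' :=
  fun k h1 h2 => h k h1 (h2.trans hn)

theorem AgreeTo.update {n : ℕ} {x x' : ℕ → ZMod 2} (h : AgreeTo n x x') (b : ZMod 2) :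
    AgreeTo (n + 1) (update x (n + 1) b) (update x' (n + 1) b) := by
  intro k h1 h2
  by_cases hk : k = n + 1
  · subst hk; simp
  · rw [update_of_ne hk, update_of_ne hk]; exact h k h1 (by omega)

theorem AgreeTo.update_at {n : ℕ} (hn : 1 ≤ n) {x x' : ℕ → ZMod 2} (h : AgreeTo (n - 1) x x')
    (b : ZMod 2) : AgreeTo n (Function.update x n b) (Function.update x' n b) := by
  obtain ⟨n, rfl⟩ : ∃ k, n = k + 1 := ⟨n - 1, by omega⟩
  exact h.update b

theorem agreeTo_update {n j : ℕ} (h : n < j) (x : ℕ → ZMod 2) (b : ZMod 2) :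
    AgreeTo n (update x j b) x := fun k _ h2 => update_of_ne (by omega) _ _

theorem agreeTo_update_self (n : ℕ) {j : ℕ} {x : ℕ → ZMod 2} {b : ZMod 2} (h : x j = b) :
    AgreeTo n (update x j b) x := fun k _ _ => by rw [← h, update_eq_self]

/-- `f` only uses the entries at the positions `1, …, n`. -/
def LocalTo (n : ℕ) (f : (ℕ → ZMod 2) → ℝ) : Prop := ∀ x x', AgreeTo n x x' → f x = f x'

/-- The maximum of `f` when the `k` entries after position `j` are varied. -/
def maxOver (f : (ℕ → ZMod 2) → ℝ) : ℕ → ℕ → (ℕ → ZMod 2) → ℝ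
  | 0, _, x => f x
  | k + 1, j, x =>
    max (maxOver f k (j + 1) (update x (j + 1) 0)) (maxOver f k (j + 1) (update x (j + 1) 1))

/-- The maximum of `f` over all vectors of length `N` that extend the first `j` entries of `x`. -/
def best (N : ℕ) (f : (ℕ → ZMod 2) → ℝ) (j : ℕ) (x : ℕ → ZMod 2) : ℝ := maxOver f (N - j) j x

theorem best_of_le {N j : ℕ} (h : N ≤ j) (f : (ℕ → ZMod 2) → ℝ) (x : ℕ → ZMod 2) :
    best N f j x = f x := by
  unfold best; rw [Nat.sub_eq_zero_of_le h]; rfl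

theorem best_of_lt {N j : ℕ} (h : j < N) (f : (ℕ → ZMod 2) → ℝ) (x : ℕ → ZMod 2) :
    best N f j x =
      max (best N f (j + 1) (update x (j + 1) 0)) (best N f (j + 1) (update x (j + 1) 1)) := by
  unfold best
  obtain ⟨k, hk⟩ : ∃ k, N - j = k + 1 := ⟨N - j - 1, by omega⟩
  rw [hk, show N - (j + 1) = k by omega]; rfl

theorem best_congr {N : ℕ} {f : (ℕ → ZMod 2) → ℝ} (hf : LocalTo N f) {j : ℕ}
    {x x' : ℕ → ZMod 2} (h : AgreeTo j x x') : best N f j x = best N f j x' := by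
  induction hk : N - j generalizing j x x' with
  | zero =>
    rw [best_of_le (by omega), best_of_le (by omega)]
    exact hf _ _ (h.mono (by omega))
  | succ k ih =>
    rw [best_of_lt (by omega), best_of_lt (j := j) (x := x') (by omega), ih (h.update 0) (by omega),
      ih (h.update 1) (by omega)]

/-- The max-log LLR of the entry at position `j`, given the entries before it. -/
def llr (N : ℕ) (f : (ℕ → ZMod 2) → ℝ) (j : ℕ) (x : ℕ → ZMod 2) : ℝ :=
  best N f j (update x j 0) - best N f j (update x j 1)

/-- Entry `j` is overwritten in both terms, so only the entries strictly before it matter. Stored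
LLRs rely on this to survive later decisions. -/
theorem llr_congr {N : ℕ} {f : (ℕ → ZMod 2) → ℝ} (hf : LocalTo N f) {j : ℕ} (hj : 1 ≤ j)
    {x x' : ℕ → ZMod 2} (h : AgreeTo (j - 1) x x') : llr N f j x = llr N f j x' := by
  unfold llr
  rw [best_congr hf (h.update_at hj 0), best_congr hf (h.update_at hj 1)]

/-- Together with `exists_best` this identifies the recursively defined `best` with a true maximum,
once the prefix is empty. The entries of `x'` are filled in one at a time. -/
theorem le_best {N : ℕ} {f : (ℕ → ZMod 2) → ℝ} (hf : LocalTo N f) {j : ℕ}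
    {x x' : ℕ → ZMod 2} (h : AgreeTo j x x') : f x' ≤ best N f j x := by
  induction hk : N - j generalizing j x with
  | zero => rw [best_of_le (by omega)]; exact (hf _ _ (h.mono (by omega))).ge
  | succ k ih =>
    rw [best_of_lt (by omega)]
    have key : f x' ≤ best N f (j + 1) (update x (j + 1) (x' (j + 1))) := by
      refine ih ?_ (by omega)
      intro i h1 h2
      by_cases hi : i = j + 1
      · subst hi; simp
      · rw [update_of_ne hi]; exact h i h1 (by omega)
    rcases zmod_two_cases (x' (j + 1)) with hb | hb <;> rw [hb] at key
    · exact key.trans (le_max_left _ _)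
    · exact key.trans (le_max_right _ _)

theorem exists_best (N : ℕ) (f : (ℕ → ZMod 2) → ℝ) (j : ℕ) (x : ℕ → ZMod 2) :
    ∃ x', best N f j x = f x' := by
  induction hk : N - j generalizing j x with
  | zero => exact ⟨x, best_of_le (by omega) _ _⟩
  | succ k ih =>
    rw [best_of_lt (by omega)]
    rcases max_choice (best N f (j + 1) (update x (j + 1) 0))
      (best N f (j + 1) (update x (j + 1) 1)) with h | h <;> rw [h] <;> exact ih _ _ (by omega)

/-! ### The polarization step -/

/-- The first component vector, `(v₁ + v₂, v₃ + v₄, …)`. -/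
def upper (v : ℕ → ZMod 2) (i : ℕ) : ZMod 2 := v (2 * i - 1) + v (2 * i)

/-- The second component vector, `(v₂, v₄, …)`. -/
def lower (v : ℕ → ZMod 2) (i : ℕ) : ZMod 2 := v (2 * i)

theorem AgreeTo.upper {n i : ℕ} (hn : 2 * i ≤ n) {v w : ℕ → ZMod 2} (h : AgreeTo n v w) :
    AgreeTo i (upper v) (upper w) := fun k h1 h2 => by
  unfold ABSPlus.upper; rw [h _ (by omega) (by omega), h _ (by omega) (by omega)]

theorem AgreeTo.lower {n i : ℕ} (hn : 2 * i ≤ n) {v w : ℕ → ZMod 2} (h : AgreeTo n v w) :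
    AgreeTo i (lower v) (lower w) := fun k h1 h2 => by
  unfold ABSPlus.lower; rw [h _ (by omega) (by omega)]

/-- The score of a vector whose two components are scored separately. -/
def pairScore (f g : (ℕ → ZMod 2) → ℝ) (v : ℕ → ZMod 2) : ℝ := f (upper v) + g (lower v)

theorem LocalTo.pairScore {N : ℕ} {f g : (ℕ → ZMod 2) → ℝ} (hf : LocalTo N f)
    (hg : LocalTo N g) : LocalTo (2 * N) (pairScore f g) := fun x x' h => by
  unfold ABSPlus.pairScore
  rw [hf _ _ (h.upper le_rfl), hg _ _ (h.lower le_rfl)]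

theorem max_add_max_two (a b c d : ℝ) :
    max a b + max c d = max (max (a + c) (b + d)) (max (b + c) (a + d)) := by
  simp only [max_def]; split_ifs <;> linarith

theorem upper_agree {i : ℕ} (hi : 1 ≤ i) {v w : ℕ → ZMod 2} (h : AgreeTo (2 * i - 2) w v) :
    AgreeTo i (upper w) (update (upper v) i (w (2 * i - 1) + w (2 * i))) := by
  intro k h1 h2
  by_cases hk : k = i
  · subst hk; simp [upper]
  · rw [update_of_ne hk]; exact h.upper (i := i - 1) (by omega) k h1 (by omega)

theorem lower_agree {i : ℕ} (hi : 1 ≤ i) {v w : ℕ → ZMod 2} (h : AgreeTo (2 * i - 2) w v) :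
    AgreeTo i (lower w) (update (lower v) i (w (2 * i))) := by
  intro k h1 h2
  by_cases hk : k = i
  · subst hk; simp [lower]
  · rw [update_of_ne hk]; exact h.lower (i := i - 1) (by omega) k h1 (by omega)

/-- The remaining entries come in pairs `(a, b)`, and `(a, b) ↦ (a + b, b)` is a bijection onto
pairs of component entries. Hence the maximum of the sum splits. The downward induction fixes one
pair at a time, and `max_add_max_two` regroups the four cases. -/
theorem best_pairScore {N : ℕ} {f g : (ℕ → ZMod 2) → ℝ} (hf : LocalTo N f) (hg : LocalTo N g)
    {i : ℕ} (hi : i ≤ N) (v : ℕ → ZMod 2) :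
    best (2 * N) (pairScore f g) (2 * i) v = best N f i (upper v) + best N g i (lower v) := by
  induction hk : N - i generalizing i v with
  | zero =>
    rw [best_of_le (by omega), best_of_le (by omega), best_of_le (by omega)]; rfl
  | succ k ih =>
    rw [best_of_lt (by omega : 2 * i < 2 * N), best_of_lt (by omega : 2 * i + 1 < 2 * N),
      best_of_lt (by omega : 2 * i + 1 < 2 * N), best_of_lt (by omega : i < N),
      best_of_lt (by omega : i < N), show 2 * i + 1 + 1 = 2 * (i + 1) by ring,
      ih (by omega) _ (by omega), ih (by omega) _ (by omega), ih (by omega) _ (by omega),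
      ih (by omega) _ (by omega), max_add_max_two]
    have agree : ∀ a b : ZMod 2, AgreeTo (2 * (i + 1) - 2)
        (update (update v (2 * i + 1) a) (2 * (i + 1)) b) v := fun a b =>
      (agreeTo_update (by omega) _ _).trans (agreeTo_update (by omega) _ _)
    have hu : ∀ a b : ZMod 2,
        best N f (i + 1) (upper (update (update v (2 * i + 1) a) (2 * (i + 1)) b)) =
          best N f (i + 1) (update (upper v) (i + 1) (a + b)) := by
      intro a b
      have := upper_agree (by omega) (agree a b)
      rw [update_self, show 2 * (i + 1) - 1 = 2 * i + 1 by omega, update_of_ne (by omega),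
        update_self] at this
      exact best_congr hf this
    have hl : ∀ a b : ZMod 2,
        best N g (i + 1) (lower (update (update v (2 * i + 1) a) (2 * (i + 1)) b)) =
          best N g (i + 1) (update (lower v) (i + 1) b) := by
      intro a b
      have := lower_agree (by omega) (agree a b)
      rw [update_self] at this
      exact best_congr hg this
    simp only [hu, hl, zmod_two_one_add_one, add_zero, zero_add]

/-- Scores of the prefixes of length `2 * i`, from tables for position `i` of the components. -/
theorem best_pairScore_even {N : ℕ} {f g : (ℕ → ZMod 2) → ℝ} (hf : LocalTo N f)
    (hg : LocalTo N g) {i : ℕ} (h1 : 1 ≤ i) (hi : i ≤ N) {v w : ℕ → ZMod 2}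
    (h : AgreeTo (2 * i - 2) w v) :
    best (2 * N) (pairScore f g) (2 * i) w =
      best N f i (update (upper v) i (w (2 * i - 1) + w (2 * i))) +
        best N g i (update (lower v) i (w (2 * i))) := by
  rw [best_pairScore hf hg hi, best_congr hf (upper_agree h1 h), best_congr hg (lower_agree h1 h)]

theorem best_pairScore_next {N : ℕ} {f g : (ℕ → ZMod 2) → ℝ} (hf : LocalTo N f)
    (hg : LocalTo N g) {i : ℕ} (h1 : 1 ≤ i) (hi : i < N) {v w : ℕ → ZMod 2}
    (h : AgreeTo (2 * i - 2) w v) :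
    best (2 * N) (pairScore f g) (2 * i + 2) w =
      best N f (i + 1) (update (update (upper v) i (w (2 * i - 1) + w (2 * i))) (i + 1)
        (w (2 * i + 1) + w (2 * i + 2))) +
        best N g (i + 1) (update (update (lower v) i (w (2 * i))) (i + 1) (w (2 * i + 2))) := by
  rw [show 2 * i + 2 = 2 * (i + 1) by ring, best_pairScore_even hf hg (by omega) hi
    (v := w) (fun _ _ _ => rfl), show 2 * (i + 1) - 1 = 2 * i + 1 by omega,
    best_congr hf ((upper_agree h1 h).update _), best_congr hg ((lower_agree h1 h).update _)]

namespace Code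

variable {m : ℕ}

/-! ### The adjacent-bit transform, coordinatewise -/

/-- The vector `u * Q l`, as a function of the positions counted from one. -/
def mix (C : Code m) (l : ℕ) (u : ℕ → ZMod 2) (j : ℕ) : ZMod 2 :=
  if j ∈ C.S l then u (j + 1)
  else if j ∈ C.A l then u j + u (j + 1)
  else if j - 1 ∈ C.S l then u (j - 1)
  else u j

theorem mem_I {C : Code m} {l i : ℕ} : i ∈ C.I l ↔ i ∈ C.S l ∨ i ∈ C.A l := Finset.mem_union

theorem mem_A_of_mem_I {C : Code m} {l i : ℕ} (h : i ∈ C.I l) (hS : i ∉ C.S l) : i ∈ C.A l :=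
  (mem_I.1 h).resolve_left hS

section Layer

variable (C : Code m) {l : ℕ} (h1 : 1 ≤ l) (hl : l ≤ m)

include h1 hl

theorem pos_of_mem_I {i : ℕ} (hi : i ∈ C.I l) : 1 ≤ i ∧ i + 1 ≤ 2 ^ l := C.range l h1 hl i hi

theorem odd_not_mem_I {i : ℕ} (hi : i % 2 = 1) : i ∉ C.I l := fun h => by
  have := C.even l h1 hl i h
  rw [Nat.even_iff] at this; omega

theorem zero_not_mem_I : 0 ∉ C.I l := fun h => by
  have := C.pos_of_mem_I h1 hl h; omega

theorem add_two_not_mem_I {i : ℕ} (hi : i ∈ C.I l) : i + 2 ∉ C.I l := fun h => by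
  have := C.gap l h1 hl i hi (i + 2) h (by omega); omega

theorem add_one_not_mem_I {i : ℕ} (hi : i ∈ C.I l) : i + 1 ∉ C.I l := fun h => by
  have := C.gap l h1 hl i hi (i + 1) h (by omega); omega

theorem sub_two_not_mem_I {i : ℕ} (hi : i ∈ C.I l) : i - 2 ∉ C.I l := fun h => by
  have h2 := C.pos_of_mem_I h1 hl hi
  have := C.gap l h1 hl (i - 2) h i hi (by omega); omega

omit h1 hl in
theorem mix_of_not_mem {j : ℕ} (hj : j ∉ C.I l) (hj' : j - 1 ∉ C.I l) (u : ℕ → ZMod 2) :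
    C.mix l u j = u j := by
  rw [mem_I, not_or] at hj hj'
  simp [mix, hj, hj']

omit h1 hl in
theorem mix_swap {i : ℕ} (hi : i ∈ C.S l) (u : ℕ → ZMod 2) : C.mix l u i = u (i + 1) := by
  simp [mix, hi]

theorem mix_swap_succ {i : ℕ} (hi : i ∈ C.S l) (u : ℕ → ZMod 2) : C.mix l u (i + 1) = u i := by
  have := C.add_one_not_mem_I h1 hl (mem_I.2 (Or.inl hi))
  rw [mem_I, not_or] at this
  simp [mix, hi, this]

theorem not_mem_S_of_mem_A {i : ℕ} (hi : i ∈ C.A l) : i ∉ C.S l := fun h =>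
  Finset.disjoint_left.1 (C.disj l h1 hl) h hi

theorem mix_add {i : ℕ} (hi : i ∈ C.A l) (u : ℕ → ZMod 2) :
    C.mix l u i = u i + u (i + 1) := by
  simp [mix, hi, C.not_mem_S_of_mem_A h1 hl hi]

theorem mix_add_succ {i : ℕ} (hi : i ∈ C.A l) (u : ℕ → ZMod 2) :
    C.mix l u (i + 1) = u (i + 1) := by
  have := C.add_one_not_mem_I h1 hl (mem_I.2 (Or.inr hi))
  rw [mem_I, not_or] at this
  simp [mix, this, C.not_mem_S_of_mem_A h1 hl hi]

/-- Since `j ∉ I l`, no pair straddles the cut between `j` and `j + 1`, so the transform acts on the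
two sides separately. -/
theorem agreeTo_mix {j : ℕ} (hj : j ∉ C.I l) {u u' : ℕ → ZMod 2} (h : AgreeTo j u u') :
    AgreeTo j (C.mix l u) (C.mix l u') := by
  intro k hk1 hk2
  have hne : k ∈ C.I l → k + 1 ≤ j := fun hk => by
    have : k ≠ j := fun e => hj (e ▸ hk)
    omega
  have hpred : k - 1 ∈ C.S l → 1 ≤ k - 1 := fun hk =>
    (C.pos_of_mem_I h1 hl (mem_I.2 (Or.inl hk))).1
  unfold mix
  split_ifs with hS hA hS'
  · exact h _ (by omega) (hne (mem_I.2 (Or.inl hS)))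
  · rw [h _ hk1 hk2, h _ (by omega) (hne (mem_I.2 (Or.inr hA)))]
  · exact h _ (hpred hS') (by omega)
  · exact h _ hk1 hk2

theorem localTo_mix {f : (ℕ → ZMod 2) → ℝ} (hf : LocalTo (2 ^ l) f) :
    LocalTo (2 ^ l) fun u => f (C.mix l u) := fun _ _ h =>
  hf _ _ (C.agreeTo_mix h1 hl (fun hmem => by
    have := C.pos_of_mem_I h1 hl hmem; omega) h)

theorem mix_update {j : ℕ} (h0 : 1 ≤ j) (hj : j ∉ C.I l) (hj' : j - 1 ∉ C.I l)
    (u : ℕ → ZMod 2) (b : ZMod 2) :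
    AgreeTo j (C.mix l (update u j b)) (update (C.mix l u) j b) := by
  intro k hk1 hk2
  by_cases hk : k = j
  · subst hk; rw [C.mix_of_not_mem hj hj']; simp
  · rw [update_of_ne hk]
    exact C.agreeTo_mix h1 hl hj' (agreeTo_update (by omega) _ _) k hk1 (by omega)

/-- Below such a cut the transform permutes the possible continuations, so the maximum is unchanged.
If a pair starts at `j + 1`, the prefix of length `j + 1` is not carried to a prefix; the induction
then moves by two positions and compares the four values of the pair at once. -/
theorem best_mix {f : (ℕ → ZMod 2) → ℝ} (hf : LocalTo (2 ^ l) f) {j : ℕ} (hj : j ∉ C.I l)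
    (u : ℕ → ZMod 2) :
    best (2 ^ l) (fun u => f (C.mix l u)) j u = best (2 ^ l) f j (C.mix l u) := by
  induction hk : 2 ^ l - j using Nat.strong_induction_on generalizing j u with
  | _ k ih =>
  subst hk
  rcases le_or_gt (2 ^ l) j with hle | hlt
  · rw [best_of_le hle, best_of_le hle]
  by_cases hj1 : j + 1 ∈ C.I l
  · have hr := (C.pos_of_mem_I h1 hl hj1).2
    have hj2 : j + 2 ∉ C.I l := C.add_one_not_mem_I h1 hl hj1
    have key : ∀ a b : ZMod 2, best (2 ^ l) (fun u => f (C.mix l u)) (j + 2)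
        (update (update u (j + 1) a) (j + 2) b) = best (2 ^ l) f (j + 2)
          (update (update (C.mix l u) (j + 1) (if j + 1 ∈ C.S l then b else a + b)) (j + 2)
            (if j + 1 ∈ C.S l then a else b)) := by
      intro a b
      rw [ih _ (by omega) hj2 _ rfl]
      refine best_congr hf fun k hk1 hk2 => ?_
      rcases (by omega : k ≤ j ∨ k = j + 1 ∨ k = j + 2) with hk | rfl | rfl
      · rw [update_of_ne (by omega), update_of_ne (by omega)]
        exact C.agreeTo_mix h1 hl hj ((agreeTo_update (by omega) _ _).trans
          (agreeTo_update (by omega) _ _)) k hk1 hk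
      · by_cases hS : j + 1 ∈ C.S l
        · rw [C.mix_swap hS]; simp [hS]
        · rw [C.mix_add h1 hl (mem_A_of_mem_I hj1 hS)]; simp [hS]
      · by_cases hS : j + 1 ∈ C.S l
        · rw [C.mix_swap_succ h1 hl hS]; simp [hS]
        · rw [C.mix_add_succ h1 hl (mem_A_of_mem_I hj1 hS)]; simp [hS]
    rw [best_of_lt hlt, best_of_lt (by omega : j + 1 < 2 ^ l),
      best_of_lt (by omega : j + 1 < 2 ^ l), best_of_lt hlt,
      best_of_lt (by omega : j + 1 < 2 ^ l), best_of_lt (by omega : j + 1 < 2 ^ l)]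
    simp only [show j + 1 + 1 = j + 2 from rfl, key]
    by_cases hS : j + 1 ∈ C.S l
    · simp only [hS, if_true]; exact max_max_max_comm _ _ _ _
    · simp only [hS, if_false, zmod_two_one_add_one, add_zero, zero_add]
      simp only [max_def]; split_ifs <;> linarith
  · rw [best_of_lt hlt, best_of_lt hlt, ih _ (by omega) hj1 _ rfl, ih _ (by omega) hj1 _ rfl,
      best_congr hf (C.mix_update h1 hl (by omega) hj1 hj u 0),
      best_congr hf (C.mix_update h1 hl (by omega) hj1 hj u 1)]

end Layer

end Code

/-! ### Tables of prefix scores at a pair of positions -/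

section Tables

variable {N : ℕ} {f g : (ℕ → ZMod 2) → ℝ} (hf : LocalTo N f) (hg : LocalTo N g)

/-- Best score of the vectors that agree with `v` up to position `2 * i - 2` and continue with
`r, a`. -/
def score₂ (N : ℕ) (f g : (ℕ → ZMod 2) → ℝ) (v : ℕ → ZMod 2) (i : ℕ) (r a : ZMod 2) : ℝ :=
  best (2 * N) (pairScore f g) (2 * i) (update (update v (2 * i - 1) r) (2 * i) a)

/-- Best score of the vectors that agree with `v` up to position `2 * i - 2` and continue with
`r, a, b`. -/
def score₃ (N : ℕ) (f g : (ℕ → ZMod 2) → ℝ) (v : ℕ → ZMod 2) (i : ℕ) (r a b : ZMod 2) : ℝ :=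
  best (2 * N) (pairScore f g) (2 * i + 1)
    (update (update (update v (2 * i - 1) r) (2 * i) a) (2 * i + 1) b)

include hf hg

theorem best_eq_score₂ {i : ℕ} {v w : ℕ → ZMod 2}
    (h : AgreeTo (2 * i - 2) w v) :
    best (2 * N) (pairScore f g) (2 * i) w = score₂ N f g v i (w (2 * i - 1)) (w (2 * i)) := by
  refine best_congr (hf.pairScore hg) fun k hk1 hk2 => ?_
  rcases (by omega : k ≤ 2 * i - 2 ∨ k = 2 * i - 1 ∨ k = 2 * i) with hk | rfl | rfl
  · rw [update_of_ne (by omega), update_of_ne (by omega), h k hk1 hk]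
  · rw [update_of_ne (by omega), update_self]
  · rw [update_self]

theorem best_eq_score₃ {i : ℕ} {v w : ℕ → ZMod 2}
    (h : AgreeTo (2 * i - 2) w v) :
    best (2 * N) (pairScore f g) (2 * i + 1) w =
      score₃ N f g v i (w (2 * i - 1)) (w (2 * i)) (w (2 * i + 1)) := by
  refine best_congr (hf.pairScore hg) fun k hk1 hk2 => ?_
  rcases (by omega : k ≤ 2 * i - 2 ∨ k = 2 * i - 1 ∨ k = 2 * i ∨ k = 2 * i + 1) with
    hk | rfl | rfl | rfl
  · rw [update_of_ne (by omega), update_of_ne (by omega), update_of_ne (by omega), h k hk1 hk]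
  · rw [update_of_ne (by omega), update_of_ne (by omega), update_self]
  · rw [update_of_ne (by omega), update_self]
  · rw [update_self]

theorem score₂_eq {i : ℕ} (h1 : 1 ≤ i) (hi : i ≤ N) (v : ℕ → ZMod 2) (r a : ZMod 2) :
    score₂ N f g v i r a =
      best N f i (update (upper v) i (r + a)) + best N g i (update (lower v) i a) := by
  unfold score₂
  rw [best_pairScore_even hf hg h1 hi (v := v), update_self, update_of_ne (by omega), update_self]
  exact (agreeTo_update (by omega) _ _).trans (agreeTo_update (by omega) _ _)

omit hf hg in
theorem score₂_eq_max {i : ℕ} (hi : i < N) (v : ℕ → ZMod 2) (r a : ZMod 2) :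
    score₂ N f g v i r a = max (score₃ N f g v i r a 0) (score₃ N f g v i r a 1) :=
  best_of_lt (by omega) _ _

theorem fPlus_llr {i : ℕ} (h1 : 1 ≤ i) (hi : i ≤ N) (v : ℕ → ZMod 2) (r : ZMod 2) :
    fPlus (llr N f i (upper v)) (llr N g i (lower v)) r =
      score₂ N f g v i r 0 - score₂ N f g v i r 1 := by
  rw [score₂_eq hf hg h1 hi, score₂_eq hf hg h1 hi, add_zero]
  exact fPlus_sub_sub (fun b => best N f i (update (upper v) i b))
    (fun b => best N g i (update (lower v) i b)) r

theorem fMinus_llr {i : ℕ} (h1 : 1 ≤ i) (hi : i ≤ N) (v : ℕ → ZMod 2) :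
    fMinus (llr N f i (upper v)) (llr N g i (lower v)) =
      max (score₂ N f g v i 0 0) (score₂ N f g v i 0 1) -
        max (score₂ N f g v i 1 0) (score₂ N f g v i 1 1) := by
  simp only [score₂_eq hf hg h1 hi, add_zero, zero_add, zmod_two_one_add_one]
  exact fMinus_sub_sub _ _ _ _

/-- The fourth bit `c` is maximized out; the component entries at `i + 1` are then `b + c` and `c`.
-/
theorem score₃_eq {i : ℕ} (h1 : 1 ≤ i) (hi : i < N) (v : ℕ → ZMod 2) (r a b : ZMod 2) :
    score₃ N f g v i r a b = max
      (best N f (i + 1) (update (update (upper v) i (r + a)) (i + 1) b) +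
        best N g (i + 1) (update (update (lower v) i a) (i + 1) 0))
      (best N f (i + 1) (update (update (upper v) i (r + a)) (i + 1) (b + 1)) +
        best N g (i + 1) (update (update (lower v) i a) (i + 1) 1)) := by
  unfold score₃
  have agree : ∀ c : ZMod 2, AgreeTo (2 * i - 2) (update (update (update (update v (2 * i - 1) r)
      (2 * i) a) (2 * i + 1) b) (2 * i + 1 + 1) c) v := fun c =>
    (((agreeTo_update (by omega) _ _).trans (agreeTo_update (by omega) _ _)).trans
      (agreeTo_update (by omega) _ _)).trans (agreeTo_update (by omega) _ _)
  rw [best_of_lt (by omega), best_pairScore_next hf hg h1 hi (agree 0),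
    best_pairScore_next hf hg h1 hi (agree 1)]
  have e1 : 2 * i - 1 ≠ 2 * i := by omega
  have e2 : 2 * i - 1 ≠ 2 * i + 1 := by omega
  have e3 : 2 * i - 1 ≠ 2 * i + 1 + 1 := by omega
  have e4 : 2 * i ≠ 2 * i + 1 + 1 := by omega
  simp [e1, e2, e3, e4]

theorem fMinus_llr_next {i : ℕ} (h1 : 1 ≤ i) (hi : i < N) (v : ℕ → ZMod 2) (r a : ZMod 2) :
    fMinus (llr N f (i + 1) (update (upper v) i (r + a)))
        (llr N g (i + 1) (update (lower v) i a)) =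
      score₃ N f g v i r a 0 - score₃ N f g v i r a 1 := by
  simp only [score₃_eq hf hg h1 hi, zero_add, zmod_two_one_add_one]
  exact fMinus_sub_sub _ _ _ _

end Tables

namespace Code

variable {m : ℕ}

/-! ### LLRs after the adjacent-bit transform -/

section Node

variable (C : Code m) {l : ℕ} (hl : l + 1 ≤ m) {f g : (ℕ → ZMod 2) → ℝ}
  (hf : LocalTo (2 ^ l) f) (hg : LocalTo (2 ^ l) g) {i : ℕ} (h1 : 1 ≤ i)

/-- The score of a vector of layer `l`, from the scores of the two component vectors. -/
def nodeScore (C : Code m) (l : ℕ) (f g : (ℕ → ZMod 2) → ℝ) (u : ℕ → ZMod 2) : ℝ :=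
  pairScore f g (C.mix l u)

include hf hg in
theorem localTo_pairScore_pow : LocalTo (2 ^ (l + 1)) (pairScore f g) := by
  rw [pow_succ']; exact hf.pairScore hg

include hl hf hg in
theorem localTo_nodeScore : LocalTo (2 ^ (l + 1)) (C.nodeScore (l + 1) f g) :=
  C.localTo_mix (by omega) hl (localTo_pairScore_pow hf hg)

include hl hf hg in
theorem best_nodeScore {j : ℕ} (hj : j ∉ C.I (l + 1)) (u : ℕ → ZMod 2) :
    best (2 ^ (l + 1)) (C.nodeScore (l + 1) f g) j u =
      best (2 * 2 ^ l) (pairScore f g) j (C.mix (l + 1) u) := by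
  rw [← pow_succ']
  exact C.best_mix (by omega) hl (localTo_pairScore_pow hf hg) hj u

include hl hf hg h1

/-- The right-hand neighbour is maximized out, so it does not matter whether the pair `2 * i, 2 * i
+ 1` is transformed; only a pair ending at `2 * i - 1` must be excluded. -/
theorem llr_nodeScore_first (hi : i ≤ 2 ^ l) (hI : 2 * i - 2 ∉ C.I (l + 1)) (z : ℕ → ZMod 2) :
    llr (2 ^ (l + 1)) (C.nodeScore (l + 1) f g) (2 * i - 1) z =
      fMinus (llr (2 ^ l) f i (upper (C.mix (l + 1) z)))
        (llr (2 ^ l) g i (lower (C.mix (l + 1) z))) := by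
  have hodd : 2 * i - 1 ∉ C.I (l + 1) := C.odd_not_mem_I (by omega) hl (by omega)
  have hloc := hf.pairScore hg
  have key : ∀ b, best (2 ^ (l + 1)) (C.nodeScore (l + 1) f g) (2 * i - 1)
      (update z (2 * i - 1) b) = max (score₂ (2 ^ l) f g (C.mix (l + 1) z) i b 0)
        (score₂ (2 ^ l) f g (C.mix (l + 1) z) i b 1) := by
    intro b
    rw [C.best_nodeScore hl hf hg hodd, best_congr hloc
      (C.mix_update (by omega) hl (by omega) hodd hI z b), best_of_lt (by omega),
      show 2 * i - 1 + 1 = 2 * i by omega]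
    rfl
  rw [fMinus_llr hf hg h1 hi, llr, key, key]

theorem llr_nodeScore_second (hi : i ≤ 2 ^ l) (hI : 2 * i ∉ C.I (l + 1)) {v w : ℕ → ZMod 2}
    (h : AgreeTo (2 * i - 2) (C.mix (l + 1) w) v) :
    llr (2 ^ (l + 1)) (C.nodeScore (l + 1) f g) (2 * i) w =
      fPlus (llr (2 ^ l) f i (upper v)) (llr (2 ^ l) g i (lower v))
        (C.mix (l + 1) w (2 * i - 1)) := by
  have hodd : 2 * i - 1 ∉ C.I (l + 1) := C.odd_not_mem_I (by omega) hl (by omega)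
  have hloc := hf.pairScore hg
  have key : ∀ b, best (2 ^ (l + 1)) (C.nodeScore (l + 1) f g) (2 * i) (update w (2 * i) b) =
      score₂ (2 ^ l) f g v i (C.mix (l + 1) w (2 * i - 1)) b := by
    intro b
    rw [C.best_nodeScore hl hf hg hI, best_congr hloc
      (C.mix_update (by omega) hl (by omega) hI hodd w b),
      best_eq_score₂ hf hg ((agreeTo_update (by omega) _ _).trans h), update_self,
      update_of_ne (by omega)]
  rw [fPlus_llr hf hg h1 hi, llr, key, key]

theorem llr_nodeScore_cond (hi : i < 2 ^ l) (hI : 2 * i ∉ C.I (l + 1)) {v w : ℕ → ZMod 2}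
    (h : AgreeTo (2 * i - 2) (C.mix (l + 1) w) v) :
    llr (2 ^ (l + 1)) (C.nodeScore (l + 1) f g) (2 * i + 1) w =
      fMinus (llr (2 ^ l) f (i + 1)
          (update (upper v) i (C.mix (l + 1) w (2 * i - 1) + C.mix (l + 1) w (2 * i))))
        (llr (2 ^ l) g (i + 1) (update (lower v) i (C.mix (l + 1) w (2 * i)))) := by
  have hodd : 2 * i + 1 ∉ C.I (l + 1) := C.odd_not_mem_I (by omega) hl (by omega)
  have hloc := hf.pairScore hg
  have key : ∀ b, best (2 ^ (l + 1)) (C.nodeScore (l + 1) f g) (2 * i + 1)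
      (update w (2 * i + 1) b) =
      score₃ (2 ^ l) f g v i (C.mix (l + 1) w (2 * i - 1)) (C.mix (l + 1) w (2 * i)) b := by
    intro b
    rw [C.best_nodeScore hl hf hg hodd, best_congr hloc
      (C.mix_update (by omega) hl (by omega) hodd hI w b),
      best_eq_score₃ hf hg ((agreeTo_update (by omega) _ _).trans h), update_self,
      update_of_ne (by omega), update_of_ne (by omega)]
  rw [fMinus_llr_next hf hg h1 hi, llr, key, key]

/-- Prefix scores at a transformed pair. -/
theorem best_nodeScore_pair (hI : 2 * i ∈ C.I (l + 1)) {v w : ℕ → ZMod 2}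
    (h : AgreeTo (2 * i - 2) (C.mix (l + 1) w) v) (b : ZMod 2) :
    best (2 ^ (l + 1)) (C.nodeScore (l + 1) f g) (2 * i + 1) (update w (2 * i + 1) b) =
      score₃ (2 ^ l) f g v i (w (2 * i - 1))
        (if 2 * i ∈ C.S (l + 1) then b else w (2 * i) + b)
        (if 2 * i ∈ C.S (l + 1) then w (2 * i) else b) := by
  have hodd : 2 * i + 1 ∉ C.I (l + 1) := C.odd_not_mem_I (by omega) hl (by omega)
  have hodd' : 2 * i - 1 ∉ C.I (l + 1) := C.odd_not_mem_I (by omega) hl (by omega)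
  have hI' : 2 * i - 2 ∉ C.I (l + 1) := C.sub_two_not_mem_I (by omega) hl hI
  have hagree : AgreeTo (2 * i - 2) (C.mix (l + 1) (update w (2 * i + 1) b)) v :=
    (C.agreeTo_mix (by omega) hl hI' (agreeTo_update (by omega) _ _)).trans h
  rw [C.best_nodeScore hl hf hg hodd, best_eq_score₃ hf hg hagree,
    C.mix_of_not_mem hodd' (by rwa [show 2 * i - 1 - 1 = 2 * i - 2 by omega]),
    update_of_ne (by omega)]
  by_cases hS : 2 * i ∈ C.S (l + 1)
  · rw [C.mix_swap hS, C.mix_swap_succ (by omega) hl hS]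
    simp [hS]
  · have hA := mem_A_of_mem_I hI hS
    rw [C.mix_add (by omega) hl hA, C.mix_add_succ (by omega) hl hA]
    simp [hS]

theorem llr_nodeScore_third (hI : 2 * i ∈ C.I (l + 1)) {v w : ℕ → ZMod 2}
    (h : AgreeTo (2 * i - 2) (C.mix (l + 1) w) v) :
    llr (2 ^ (l + 1)) (C.nodeScore (l + 1) f g) (2 * i + 1) w =
      if 2 * i ∈ C.S (l + 1) then
        score₃ (2 ^ l) f g v i (w (2 * i - 1)) 0 (w (2 * i)) -
          score₃ (2 ^ l) f g v i (w (2 * i - 1)) 1 (w (2 * i))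
      else score₃ (2 ^ l) f g v i (w (2 * i - 1)) (w (2 * i)) 0 -
          score₃ (2 ^ l) f g v i (w (2 * i - 1)) (w (2 * i) + 1) 1 := by
  rw [llr, C.best_nodeScore_pair hl hf hg h1 hI h, C.best_nodeScore_pair hl hf hg h1 hI h]
  split_ifs <;> simp

/-- The bit after the pair's first one is maximized out, so each value of the first bit picks two
cells of the table: a column for a swap, a diagonal for an addition. -/
theorem llr_nodeScore_pair (hi : i < 2 ^ l) (hI : 2 * i ∈ C.I (l + 1)) {v w : ℕ → ZMod 2}
    (h : AgreeTo (2 * i - 2) (C.mix (l + 1) w) v) :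
    llr (2 ^ (l + 1)) (C.nodeScore (l + 1) f g) (2 * i) w =
      let E := score₃ (2 ^ l) f g v i (w (2 * i - 1))
      if 2 * i ∈ C.S (l + 1) then max (E 0 0) (E 1 0) - max (E 0 1) (E 1 1)
      else max (E 0 0) (E 1 1) - max (E 1 0) (E 0 1) := by
  have hI' : 2 * i - 2 ∉ C.I (l + 1) := C.sub_two_not_mem_I (by omega) hl hI
  have hagree : ∀ a, AgreeTo (2 * i - 2) (C.mix (l + 1) (update w (2 * i) a)) v := fun a =>
    (C.agreeTo_mix (by omega) hl hI' (agreeTo_update (by omega) _ _)).trans h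
  have hlt : 2 * i < 2 ^ (l + 1) := by rw [pow_succ']; omega
  rw [llr, best_of_lt hlt, best_of_lt hlt]
  simp only [C.best_nodeScore_pair hl hf hg h1 hI (hagree _), update_self]
  rw [update_of_ne (by omega), update_of_ne (by omega)]
  split_ifs <;> simp [zmod_two_one_add_one]

/-- The gap condition gives `2 * i + 2 ∉ I (l + 1)`. All four positions of two component steps are
then known except the last, and the component scores at `i + 1` simply add. -/
theorem llr_nodeScore_fourth (hi : i < 2 ^ l) (hI : 2 * i ∈ C.I (l + 1)) {v w : ℕ → ZMod 2}
    (h : AgreeTo (2 * i - 2) (C.mix (l + 1) w) v) :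
    llr (2 ^ (l + 1)) (C.nodeScore (l + 1) f g) (2 * i + 2) w =
      fPlus (llr (2 ^ l) f (i + 1)
          (update (upper v) i (w (2 * i - 1) + C.mix (l + 1) w (2 * i))))
        (llr (2 ^ l) g (i + 1) (update (lower v) i (C.mix (l + 1) w (2 * i))))
        (C.mix (l + 1) w (2 * i + 1)) := by
  have hodd : 2 * i + 1 ∉ C.I (l + 1) := C.odd_not_mem_I (by omega) hl (by omega)
  have hodd' : 2 * i - 1 ∉ C.I (l + 1) := C.odd_not_mem_I (by omega) hl (by omega)
  have hI' : 2 * i - 2 ∉ C.I (l + 1) := C.sub_two_not_mem_I (by omega) hl hI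
  have hI2 : 2 * i + 2 ∉ C.I (l + 1) := C.add_two_not_mem_I (by omega) hl hI
  have hloc := hf.pairScore hg
  have key : ∀ b, best (2 ^ (l + 1)) (C.nodeScore (l + 1) f g) (2 * i + 2)
      (update w (2 * i + 2) b) =
      best (2 ^ l) f (i + 1) (update (update (upper v) i
        (w (2 * i - 1) + C.mix (l + 1) w (2 * i))) (i + 1) (C.mix (l + 1) w (2 * i + 1) + b)) +
      best (2 ^ l) g (i + 1)
        (update (update (lower v) i (C.mix (l + 1) w (2 * i))) (i + 1) b) := by
    intro b
    rw [C.best_nodeScore hl hf hg hI2, best_congr hloc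
      (C.mix_update (by omega) hl (by omega) hI2 hodd w b),
      best_pairScore_next hf hg h1 hi ((agreeTo_update (by omega) _ _).trans h), update_self,
      update_of_ne (by omega), update_of_ne (by omega), update_of_ne (by omega),
      C.mix_of_not_mem hodd' (by rwa [show 2 * i - 1 - 1 = 2 * i - 2 by omega])]
  rw [llr, key, key, add_zero]
  exact (fPlus_sub_sub (fun b => best (2 ^ l) f (i + 1) (update (update (upper v) i
      (w (2 * i - 1) + C.mix (l + 1) w (2 * i))) (i + 1) b))
    (fun b => best (2 ^ l) g (i + 1)
        (update (update (lower v) i (C.mix (l + 1) w (2 * i))) (i + 1) b)) _).symm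

end Node

/-! ### LLR computations of a node on one block -/

section Block

variable (C : Code m) {l : ℕ} (hl : l + 1 ≤ m) {f g : (ℕ → ZMod 2) → ℝ}
  (hf : LocalTo (2 ^ l) f) (hg : LocalTo (2 ^ l) g) {i : ℕ} (h1 : 1 ≤ i)
  {p : Path} {h β : ℕ} {v : ℕ → ZMod 2}

include hf hg h1

theorem condLLR_eq (hi : i < 2 ^ l)
    (hR : ∀ b, p.R l β b = llr (2 ^ l) f (i + 1) (update (upper v) i b))
    (hR' : ∀ b, p.R l (β + h) b = llr (2 ^ l) g (i + 1) (update (lower v) i b)) (r b : ZMod 2) :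
    condLLR p l h β r b = score₃ (2 ^ l) f g v i r b 0 - score₃ (2 ^ l) f g v i r b 1 := by
  rw [condLLR, hR, hR', fMinus_llr_next hf hg h1 hi]

/-- The plus-LLR is the difference of the row maxima of `score₃`, since each `score₂` maximizes over
the next bit, and the conditional LLRs are the differences within the rows; the table identities
apply. -/
theorem interLLR_eq_score₃ (hi : i < 2 ^ l) (hL : p.L l β = llr (2 ^ l) f i (upper v))
    (hL' : p.L l (β + h) = llr (2 ^ l) g i (lower v))
    (hR : ∀ b, p.R l β b = llr (2 ^ l) f (i + 1) (update (upper v) i b))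
    (hR' : ∀ b, p.R l (β + h) b = llr (2 ^ l) g (i + 1) (update (lower v) i b)) (r c : ZMod 2) :
    C.interLLR p l i h β r c =
      if 2 * i ∈ C.S (l + 1) then
        score₃ (2 ^ l) f g v i r 0 c - score₃ (2 ^ l) f g v i r 1 c
      else score₃ (2 ^ l) f g v i r c 0 - score₃ (2 ^ l) f g v i r (c + 1) 1 := by
  simp only [interLLR, hL, hL', fPlus_llr hf hg h1 hi.le, condLLR_eq hf hg h1 hi hR hR',
    score₂_eq_max hi, swapLLR_eq, addLLR_eq]

include hl

theorem interLLR_eq (hI : 2 * i ∈ C.I (l + 1)) (hi : i < 2 ^ l)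
    (hL : p.L l β = llr (2 ^ l) f i (upper v))
    (hL' : p.L l (β + h) = llr (2 ^ l) g i (lower v))
    (hR : ∀ b, p.R l β b = llr (2 ^ l) f (i + 1) (update (upper v) i b))
    (hR' : ∀ b, p.R l (β + h) b = llr (2 ^ l) g (i + 1) (update (lower v) i b))
    {w : ℕ → ZMod 2} (hw : AgreeTo (2 * i - 2) (C.mix (l + 1) w) v) :
    C.interLLR p l i h β (w (2 * i - 1)) (w (2 * i)) =
      llr (2 ^ (l + 1)) (C.nodeScore (l + 1) f g) (2 * i + 1) w := by
  rw [C.interLLR_eq_score₃ hf hg h1 hi hL hL' hR hR', C.llr_nodeScore_third hl hf hg h1 hI hw]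

theorem secondLLR_eq (hi : i ≤ 2 ^ l) (hL : p.L l β = llr (2 ^ l) f i (upper v))
    (hL' : p.L l (β + h) = llr (2 ^ l) g i (lower v))
    (hR : 2 * i ∈ C.I (l + 1) → ∀ b, p.R l β b = llr (2 ^ l) f (i + 1) (update (upper v) i b))
    (hR' : 2 * i ∈ C.I (l + 1) →
      ∀ b, p.R l (β + h) b = llr (2 ^ l) g (i + 1) (update (lower v) i b))
    {w : ℕ → ZMod 2} (hw : AgreeTo (2 * i - 2) (C.mix (l + 1) w) v) :
    C.secondLLR p l i h β (C.mix (l + 1) w (2 * i - 1)) =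
      llr (2 ^ (l + 1)) (C.nodeScore (l + 1) f g) (2 * i) w := by
  unfold secondLLR
  by_cases hI : 2 * i ∈ C.I (l + 1)
  · have hI' : 2 * i - 2 ∉ C.I (l + 1) := C.sub_two_not_mem_I (by omega) hl hI
    have hodd : 2 * i - 1 ∉ C.I (l + 1) := C.odd_not_mem_I (by omega) hl (by omega)
    have hi' : i < 2 ^ l := by
      have := (C.pos_of_mem_I (by omega) hl hI).2
      rw [pow_succ'] at this; omega
    rw [if_neg (by simpa using hI), C.llr_nodeScore_pair hl hf hg h1 hi' hI hw,
      C.mix_of_not_mem hodd (by rwa [show 2 * i - 1 - 1 = 2 * i - 2 by omega])]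
    simp only [C.interLLR_eq_score₃ hf hg h1 hi' hL hL' (hR hI) (hR' hI),
      condLLR_eq hf hg h1 hi' (hR hI) (hR' hI)]
    split_ifs
    · exact swapFirst_eq fun a b => score₃ (2 ^ l) f g v i (w (2 * i - 1)) a b
    · rw [zero_add, zmod_two_one_add_one]
      exact addFirst_eq fun a b => score₃ (2 ^ l) f g v i (w (2 * i - 1)) a b
  · rw [if_pos hI, C.llr_nodeScore_second hl hf hg h1 hi hI hw, hL, hL']

end Block

/-! ### Scores and bits of all layers -/

/-- The score of a vector in layer `l`, at position `β`; the channel scores `ω` of its codeword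
bits belong to the positions `β, β + h, β + 2 * h, …`. -/
def score (C : Code m) (ω : ℕ → ZMod 2 → ℝ) : ℕ → ℕ → ℕ → (ℕ → ZMod 2) → ℝ
  | 0, _, β, x => ω β (x 1)
  | l + 1, h, β, x => C.nodeScore (l + 1) (score C ω l (h * 2) β) (score C ω l (h * 2) (β + h)) x

theorem localTo_score (C : Code m) (ω : ℕ → ZMod 2 → ℝ) {l : ℕ} (hl : l ≤ m) (h β : ℕ) :
    LocalTo (2 ^ l) (C.score ω l h β) := by
  induction l generalizing h β with
  | zero => intro x x' hx; simp only [score]; rw [hx 1 le_rfl (by simp)]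
  | succ l ih => exact C.localTo_nodeScore hl (ih (by omega) _ _) (ih (by omega) _ _)

/-- The LLR of the entry `j` in layer `l`, at position `β` of `1, …, 2 ^ d`. -/
def llrAt (C : Code m) (ω : ℕ → ZMod 2 → ℝ) (d l β j : ℕ) (x : ℕ → ZMod 2) : ℝ :=
  llr (2 ^ l) (C.score ω l (2 ^ d) β) j x

/-- The vector in layer `l`, at position `β` of `1, …, 2 ^ d`, that belongs to the message `u`. -/
def bit (C : Code m) : ℕ → ℕ → (ℕ → ZMod 2) → ℕ → ℕ → ZMod 2
  | 0, _, u, _ => u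
  | d + 1, l, u, β =>
    if β ≤ 2 ^ d then upper (C.mix (l + 1) (bit C d (l + 1) u β))
    else lower (C.mix (l + 1) (bit C d (l + 1) u (β - 2 ^ d)))

theorem bit_left (C : Code m) {d β : ℕ} (hβ : β ≤ 2 ^ d) (l : ℕ) (u : ℕ → ZMod 2) :
    C.bit (d + 1) l u β = upper (C.mix (l + 1) (C.bit d (l + 1) u β)) := by
  simp [bit, hβ]

theorem bit_right (C : Code m) {β : ℕ} (d : ℕ) (hβ : 1 ≤ β) (l : ℕ) (u : ℕ → ZMod 2) :
    C.bit (d + 1) l u (β + 2 ^ d) = lower (C.mix (l + 1) (C.bit d (l + 1) u β)) := by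
  simp [bit]; omega

/-- The last node of layer `l + 1` that is visited by the node `i` of layer `l`. -/
def lastChild (C : Code m) (l i : ℕ) : ℕ := if 2 * i ∈ C.I (l + 1) then 2 * i + 1 else 2 * i

/-- The last message bit that is decoded in the node `(l, i)` of height `d`. -/
def lastLeaf (C : Code m) : ℕ → ℕ → ℕ → ℕ
  | 0, _, i => i
  | d + 1, l, i => lastLeaf C d (l + 1) (C.lastChild l i)

theorem lastChild_not_mem_I (C : Code m) {l : ℕ} (hl : l + 1 ≤ m) (i : ℕ) :
    C.lastChild l i ∉ C.I (l + 1) := by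
  unfold lastChild
  split_ifs with h
  · exact C.odd_not_mem_I (by omega) hl (by omega)
  · exact h

theorem le_lastChild (C : Code m) (l i : ℕ) : 2 * i ≤ C.lastChild l i := by
  unfold lastChild; split_ifs <;> omega

theorem lastChild_le (C : Code m) (l i : ℕ) : C.lastChild l i ≤ 2 * i + 1 := by
  unfold lastChild; split_ifs <;> omega

theorem lastChild_of_mem (C : Code m) {l i : ℕ} (h : 2 * i ∈ C.I (l + 1)) :
    C.lastChild l i = 2 * i + 1 := if_pos h

theorem lastChild_of_not_mem (C : Code m) {l i : ℕ} (h : 2 * i ∉ C.I (l + 1)) :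
    C.lastChild l i = 2 * i := if_neg h

theorem lastLeaf_mono (C : Code m) (d l : ℕ) {i j : ℕ} (h : i ≤ j) :
    C.lastLeaf d l i ≤ C.lastLeaf d l j := by
  induction d generalizing l i j with
  | zero => exact h
  | succ d ih =>
    refine ih _ ?_
    rcases h.eq_or_lt with rfl | h
    · exact le_rfl
    · have := C.lastChild_le l i
      have := C.le_lastChild l j
      omega

/-- Causality of decoding: `lastChild` is at least `2 * i` and cuts no pair, so descending one layer
never requires bits beyond it. -/
theorem agreeTo_bit (C : Code m) {d l : ℕ} (hm : l + d = m) {i : ℕ} {u u' : ℕ → ZMod 2}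
    (h : AgreeTo (C.lastLeaf d l i) u u') (β : ℕ) :
    AgreeTo i (C.bit d l u β) (C.bit d l u' β) := by
  induction d generalizing l i β with
  | zero => exact h
  | succ d ih =>
    have key := fun β => C.agreeTo_mix (by omega) (by omega)
      (C.lastChild_not_mem_I (by omega : l + 1 ≤ m) i) (ih (by omega) h β)
    unfold bit
    split_ifs
    · exact (key _).upper (C.le_lastChild l i)
    · exact (key _).lower (C.le_lastChild l i)

/-! ### Right-separated nodes -/

theorem RightSeparated.not_mem {C : Code m} {l i : ℕ} (hl : l < m) (h : C.RightSeparated l i) :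
    2 * i ∉ C.I (l + 1) := by
  simpa using h 0 (by omega)

theorem RightSeparated.child {C : Code m} {l i : ℕ} (h : C.RightSeparated l i) :
    C.RightSeparated (l + 1) (2 * i) := fun k hk => by
  have := h (k + 1) (by omega)
  rwa [show 2 ^ (k + 1) * (2 * i) = 2 ^ (k + 1 + 1) * i by ring,
    show l + 1 + k + 1 = l + (k + 1) + 1 by ring]

/-- A pair straddling the right border of the node's subtree has its second member in range, so a
next entry exists. This is what makes conditional LLRs meaningful exactly where they are stored. -/
theorem lt_of_not_rightSeparated {C : Code m} {l i : ℕ} (h : ¬ C.RightSeparated l i) :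
    i < 2 ^ l := by
  unfold RightSeparated at h
  push Not at h
  obtain ⟨k, hk, hI⟩ := h
  have := (C.pos_of_mem_I (by omega) (by omega) hI).2
  rw [show l + k + 1 = (k + 1) + l by ring, pow_add _ _ l] at this
  exact lt_of_mul_lt_mul_left (by omega : 2 ^ (k + 1) * i < 2 ^ (k + 1) * 2 ^ l) (Nat.zero_le _)

/-! ### Invariants of the decoder -/

section Invariants

variable (C : Code m) (ω : ℕ → ZMod 2 → ℝ)

/-- The array `L` holds the LLRs for the node `(l, i)`. -/
def LCorrect (d l i : ℕ) (p : Path) : Prop :=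
  ∀ β, 1 ≤ β → β ≤ 2 ^ d → p.L l β = C.llrAt ω d l β i (C.bit d l p.u β)

/-- The array `R` holds the conditional LLRs of the entry after the node `(l, i)`. -/
def RCorrect (d l i : ℕ) (p : Path) : Prop :=
  ∀ β, 1 ≤ β → β ≤ 2 ^ d → ∀ b,
    p.R l β b = C.llrAt ω d l β (i + 1) (update (C.bit d l p.u β) i b)

/-- The array `B` holds the bits decoded in the node `(l, i)`. -/
def BCorrect (d l i : ℕ) (p : Path) : Prop :=
  ∀ β, 1 ≤ β → β ≤ 2 ^ d → p.B l β = C.bit d l p.u β i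

/-- What the node `(l, i)` leaves on the deeper layers for the next node of layer `l`. -/
def Leftover : ℕ → ℕ → ℕ → Path → Prop
  | 0, _, _, _ => True
  | d + 1, l, i, p =>
    C.BCorrect d (l + 1) (C.lastChild l i) p ∧
    (¬ C.RightSeparated (l + 1) (C.lastChild l i) →
      C.RCorrect ω d (l + 1) (C.lastChild l i) p) ∧
    (2 * i ∈ C.I (l + 1) → ∀ β, 1 ≤ β → β ≤ 2 ^ d →
      p.H l β = C.mix (l + 1) (C.bit d (l + 1) p.u β) (2 * i + 1)) ∧
    Leftover d (l + 1) (C.lastChild l i) p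

/-- The metric of the path is the loss in the best score caused by the first `n` decisions. -/
def MetricCorrect (n : ℕ) (p : Path) : Prop :=
  p.pm = best (2 ^ m) (C.score ω m (2 ^ 0) 1) 0 p.u - best (2 ^ m) (C.score ω m (2 ^ 0) 1) n p.u

/-- The state of a path when the node `(l, i)` of height `d` is entered. -/
structure Entry (d l i : ℕ) (p : Path) : Prop where
  L : C.LCorrect ω d l i p
  R : ¬ C.RightSeparated l i → C.RCorrect ω d l i p
  leftover : 1 < i → C.Leftover ω d l (i - 1) p
  metric : C.MetricCorrect ω (C.lastLeaf d l (i - 1)) p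

/-- The first `n` decisions and the parts of the arrays that belong to layers above are kept; so
are the LLRs of layer `l`. -/
structure Kept (l n : ℕ) (p q : Path) : Prop where
  u : AgreeTo n q.u p.u
  L : ∀ k ≤ l, q.L k = p.L k
  R : ∀ k ≤ l, q.R k = p.R k
  B : ∀ k < l, q.B k = p.B k
  H : ∀ k < l, q.H k = p.H k
  M : ∀ k < l, q.M k = p.M k

/-- The state `q` of a path after the node `(l, i)` of height `d`, entered with `p`. -/
structure Exit (d l i : ℕ) (p q : Path) : Prop where
  kept : Kept l (C.lastLeaf d l (i - 1)) p q
  B : C.BCorrect d l i q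
  leftover : C.Leftover ω d l i q
  metric : C.MetricCorrect ω (C.lastLeaf d l i) q

/-- The state of a path in the node `(l, i)` of height `d + 1`, before the child `2 * i`. -/
structure Middle (d l i : ℕ) (p : Path) : Prop where
  L : C.LCorrect ω (d + 1) l i p
  R : ¬ C.RightSeparated l i → C.RCorrect ω (d + 1) l i p
  B : ∀ β, 1 ≤ β → β ≤ 2 ^ d → p.B l β = C.mix (l + 1) (C.bit d (l + 1) p.u β) (2 * i - 1)
  B' : C.BCorrect d (l + 1) (2 * i - 1) p
  R' : ¬ C.RightSeparated (l + 1) (2 * i - 1) → C.RCorrect ω d (l + 1) (2 * i - 1) p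
  M : ¬ C.RightSeparated (l + 1) (2 * i - 1) → 2 * i ∈ C.I (l + 1) →
    ∀ β, 1 ≤ β → β ≤ 2 ^ d → ∀ b c, p.M l β b c = C.llrAt ω d (l + 1) β (2 * i + 1)
      (update (update (C.bit d (l + 1) p.u β) (2 * i - 1) b) (2 * i) c)
  leftover : C.Leftover ω d (l + 1) (2 * i - 1) p
  metric : C.MetricCorrect ω (C.lastLeaf d (l + 1) (2 * i - 1)) p

end Invariants

theorem Kept.trans {l n : ℕ} {p q r : Path} (h : Kept l n p q) (h' : Kept l n q r) :
    Kept l n p r where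
  u := h'.u.trans h.u
  L k hk := (h'.L k hk).trans (h.L k hk)
  R k hk := (h'.R k hk).trans (h.R k hk)
  B k hk := (h'.B k hk).trans (h.B k hk)
  H k hk := (h'.H k hk).trans (h.H k hk)
  M k hk := (h'.M k hk).trans (h.M k hk)

theorem Kept.mono {l l' n n' : ℕ} {p q : Path} (h : Kept l n p q) (hl : l' ≤ l) (hn : n' ≤ n) :
    Kept l' n' p q where
  u := h.u.mono hn
  L k hk := h.L k (hk.trans hl)
  R k hk := h.R k (hk.trans hl)
  B k hk := h.B k (hk.trans_le hl)
  H k hk := h.H k (hk.trans_le hl)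
  M k hk := h.M k (hk.trans_le hl)

theorem agreeTo_refl (n : ℕ) (x : ℕ → ZMod 2) : AgreeTo n x x := fun _ _ _ => rfl

/-! ### Memory that the local operations leave untouched -/

section Kept

variable (C : Code m) (l i h n : ℕ) (p : Path)

theorem kept_calcLeft : Kept l n p (C.calcLeft l i h p) where
  u := agreeTo_refl _ _
  L k hk := update_of_ne (by omega) _ _
  R k hk := by
    simp only [calcLeft]; split_ifs
    · rfl
    · exact update_of_ne (by omega) _ _
  B k hk := rfl
  H k hk := rfl
  M k hk := by
    simp only [calcLeft]; split_ifs
    · rfl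
    · exact update_of_ne (by omega) _ _

theorem kept_calcMiddle : Kept l n p (C.calcMiddle l i h p) where
  u := agreeTo_refl _ _
  L k hk := update_of_ne (by omega) _ _
  R k hk := by
    simp only [calcMiddle, calcMiddleLR]; split_ifs
    · rfl
    all_goals exact update_of_ne (by omega) _ _
  B k hk := rfl
  H k hk := rfl
  M k hk := by
    simp only [calcMiddle, calcMiddleLR, calcMiddleM]; split_ifs
    · exact update_of_ne (by omega) _ _
    · rfl

theorem kept_calcRight : Kept l n p (C.calcRight l i h p) where
  u := agreeTo_refl _ _
  L k hk := update_of_ne (by omega) _ _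
  R k hk := by
    simp only [calcRight]; split_ifs
    · rfl
    all_goals exact update_of_ne (by omega) _ _
  B k hk := rfl
  H k hk := rfl
  M k hk := rfl

/-- Only the bits of layer `l` change. -/
theorem kept_of_B {q : Path} {B : ℕ → ℕ → ZMod 2} {x : ℕ → ZMod 2}
    (hq : q = { p with B := B }) (hB : B = update p.B l x) : Kept l n p q := by
  subst hq hB
  exact ⟨agreeTo_refl _ _, fun _ _ => rfl, fun _ _ => rfl, fun k hk => update_of_ne (by omega) _ _,
    fun _ _ => rfl, fun _ _ => rfl⟩

theorem kept_saveFirst : Kept l n p (saveFirst l h p) := kept_of_B _ _ _ rfl rfl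

theorem kept_restoreFirst : Kept l n p (restoreFirst l h p) := kept_of_B _ _ _ rfl rfl

theorem kept_saveSecond : Kept l n p (saveSecond l h p) := kept_of_B _ _ _ rfl rfl

theorem kept_combineTwo : Kept l n p (combineTwo l h p) := kept_of_B _ _ _ rfl rfl

theorem combineThree_u : (C.combineThree l i h p).u = p.u := by
  unfold combineThree; split_ifs <;> rfl

theorem kept_combineThree : Kept l n p (C.combineThree l i h p) := by
  unfold combineThree
  split_ifs <;> exact ⟨agreeTo_refl _ _, fun _ _ => rfl, fun _ _ => rfl,
    fun k hk => update_of_ne (by omega) _ _, fun k hk => update_of_ne (by omega) _ _,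
    fun _ _ => rfl⟩

end Kept

/-! ### Stability of the invariants under later decisions -/

section Transfer

variable {C : Code m} {ω : ℕ → ZMod 2 → ℝ} {d l i : ℕ} {p q : Path}

theorem LCorrect.transfer (hm : l + d = m) (hi : 1 ≤ i) (h : C.LCorrect ω d l i p)
    (hL : q.L l = p.L l) (hu : AgreeTo (C.lastLeaf d l (i - 1)) q.u p.u) :
    C.LCorrect ω d l i q := fun β h1 h2 => by
  rw [hL, h β h1 h2]
  exact llr_congr (C.localTo_score ω (by omega) _ _) hi (C.agreeTo_bit hm hu β).symm

theorem RCorrect.transfer (hm : l + d = m) (hi : 1 ≤ i) (h : C.RCorrect ω d l i p)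
    (hR : q.R l = p.R l) (hu : AgreeTo (C.lastLeaf d l (i - 1)) q.u p.u) :
    C.RCorrect ω d l i q := fun β h1 h2 b => by
  rw [hR, h β h1 h2]
  exact llr_congr (C.localTo_score ω (by omega) _ _) (by omega)
    ((C.agreeTo_bit hm hu β).symm.update_at hi b)

theorem BCorrect.transfer (hm : l + d = m) (hi : 1 ≤ i) (h : C.BCorrect d l i p)
    (hB : q.B l = p.B l) (hu : AgreeTo (C.lastLeaf d l i) q.u p.u) :
    C.BCorrect d l i q := fun β h1 h2 => by
  rw [hB, h β h1 h2]
  exact (C.agreeTo_bit hm hu β i hi le_rfl).symm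

/-- The data left behind lie along the rightmost path below the node and refer only to bits up to
its last leaf, so it suffices to follow that path downwards. -/
theorem Leftover.transfer (hm : l + d = m) (hi : 1 ≤ i) (h : C.Leftover ω d l i p)
    (hB : ∀ k > l, q.B k = p.B k) (hR : ∀ k > l, q.R k = p.R k) (hH : ∀ k ≥ l, q.H k = p.H k)
    (hu : AgreeTo (C.lastLeaf d l i) q.u p.u) : C.Leftover ω d l i q := by
  induction d generalizing l i with
  | zero => trivial
  | succ d ih =>
    obtain ⟨h1, h2, h3, h4⟩ := h
    have hc := C.le_lastChild l i
    have hu' : AgreeTo (C.lastLeaf d (l + 1) (C.lastChild l i)) q.u p.u := hu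
    refine ⟨h1.transfer (by omega) (by omega) (hB _ (by omega)) hu',
      fun hs => (h2 hs).transfer (by omega) (by omega) (hR _ (by omega))
        (hu'.mono (C.lastLeaf_mono _ _ (by omega))), fun hI β hβ hβ' => ?_,
      ih (by omega) (by omega) h4 (fun k hk => hB k (by omega)) (fun k hk => hR k (by omega))
        (fun k hk => hH k (by omega)) hu'⟩
    rw [hH l le_rfl, h3 hI β hβ hβ']
    rw [C.lastChild_of_mem hI] at hu'
    exact (C.agreeTo_mix (by omega) (by omega) (C.odd_not_mem_I (by omega) (by omega) (by omega))
      (C.agreeTo_bit (by omega) hu' β) (2 * i + 1) (by omega) le_rfl).symm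

end Transfer

/-! ### Correctness of the LLR computations -/

section Steps

variable {C : Code m} {ω : ℕ → ZMod 2 → ℝ} {d l i : ℕ} {p q : Path}

/-- Definitional, because `2 ^ (d + 1)` unfolds to `2 ^ d * 2`, the stride that `score` passes down.
-/
theorem llrAt_succ (C : Code m) (ω : ℕ → ZMod 2 → ℝ) (d l β j : ℕ) (x : ℕ → ZMod 2) :
    C.llrAt ω d (l + 1) β j x = llr (2 ^ (l + 1)) (C.nodeScore (l + 1)
      (C.score ω l (2 ^ (d + 1)) β) (C.score ω l (2 ^ (d + 1)) (β + 2 ^ d))) j x := rfl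

theorem LCorrect.left (h : C.LCorrect ω (d + 1) l i p) {β : ℕ} (h1 : 1 ≤ β) (h2 : β ≤ 2 ^ d) :
    p.L l β = llr (2 ^ l) (C.score ω l (2 ^ (d + 1)) β) i
      (upper (C.mix (l + 1) (C.bit d (l + 1) p.u β))) := by
  rw [h β h1 (by rw [pow_succ]; omega), C.bit_left h2]; rfl

theorem LCorrect.right (h : C.LCorrect ω (d + 1) l i p) {β : ℕ} (h1 : 1 ≤ β) (h2 : β ≤ 2 ^ d) :
    p.L l (β + 2 ^ d) = llr (2 ^ l) (C.score ω l (2 ^ (d + 1)) (β + 2 ^ d)) i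
      (lower (C.mix (l + 1) (C.bit d (l + 1) p.u β))) := by
  rw [h (β + 2 ^ d) (by omega) (by rw [pow_succ]; omega), C.bit_right d h1]; rfl

theorem RCorrect.left (h : C.RCorrect ω (d + 1) l i p) {β : ℕ} (h1 : 1 ≤ β) (h2 : β ≤ 2 ^ d)
    (b : ZMod 2) :
    p.R l β b = llr (2 ^ l) (C.score ω l (2 ^ (d + 1)) β) (i + 1)
      (update (upper (C.mix (l + 1) (C.bit d (l + 1) p.u β))) i b) := by
  rw [h β h1 (by rw [pow_succ]; omega), C.bit_left h2]; rfl

theorem RCorrect.right (h : C.RCorrect ω (d + 1) l i p) {β : ℕ} (h1 : 1 ≤ β) (h2 : β ≤ 2 ^ d)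
    (b : ZMod 2) :
    p.R l (β + 2 ^ d) b = llr (2 ^ l) (C.score ω l (2 ^ (d + 1)) (β + 2 ^ d)) (i + 1)
      (update (lower (C.mix (l + 1) (C.bit d (l + 1) p.u β))) i b) := by
  rw [h (β + 2 ^ d) (by omega) (by rw [pow_succ]; omega), C.bit_right d h1]; rfl

variable (hm : l + (d + 1) = m) (h1 : 1 ≤ i)

include hm

theorem not_rightSeparated_of_mem (hI : 2 * i ∈ C.I (l + 1)) : ¬ C.RightSeparated l i :=
  fun h => h.not_mem (by omega) hI

include h1

theorem interLLR_correct (hI : 2 * i ∈ C.I (l + 1)) (hL : C.LCorrect ω (d + 1) l i p)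
    (hR : C.RCorrect ω (d + 1) l i p) {β : ℕ} (hβ : 1 ≤ β) (hβ' : β ≤ 2 ^ d) {w : ℕ → ZMod 2}
    (hw : AgreeTo (2 * i - 2) w (C.bit d (l + 1) p.u β)) :
    C.interLLR p l i (2 ^ d) β (w (2 * i - 1)) (w (2 * i)) =
      C.llrAt ω d (l + 1) β (2 * i + 1) w := by
  have hI' : 2 * i - 2 ∉ C.I (l + 1) := C.sub_two_not_mem_I (by omega) (by omega) hI
  exact C.interLLR_eq (by omega) (C.localTo_score ω (by omega) _ _)
    (C.localTo_score ω (by omega) _ _) h1 hI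
    (lt_of_not_rightSeparated (not_rightSeparated_of_mem hm hI)) (hL.left hβ hβ')
    (hL.right hβ hβ') (hR.left hβ hβ') (hR.right hβ hβ')
    (C.agreeTo_mix (by omega) (by omega) hI' hw)

theorem secondLLR_correct (hi : i ≤ 2 ^ l) (hL : C.LCorrect ω (d + 1) l i p)
    (hR : ¬ C.RightSeparated l i → C.RCorrect ω (d + 1) l i p) {β : ℕ} (hβ : 1 ≤ β)
    (hβ' : β ≤ 2 ^ d) {w : ℕ → ZMod 2}
    (hw : AgreeTo (2 * i - 2) (C.mix (l + 1) w) (C.mix (l + 1) (C.bit d (l + 1) p.u β))) :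
    C.secondLLR p l i (2 ^ d) β (C.mix (l + 1) w (2 * i - 1)) =
      C.llrAt ω d (l + 1) β (2 * i) w :=
  C.secondLLR_eq (by omega) (C.localTo_score ω (by omega) _ _)
    (C.localTo_score ω (by omega) _ _) h1 hi (hL.left hβ hβ') (hL.right hβ hβ')
    (fun hI => (hR (not_rightSeparated_of_mem hm hI)).left hβ hβ')
    (fun hI => (hR (not_rightSeparated_of_mem hm hI)).right hβ hβ') hw

/-! ### The three branches of a node -/

theorem odd_pred_eq (hI : 2 * i - 2 ∉ C.I (l + 1)) (u : ℕ → ZMod 2) :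
    C.mix (l + 1) u (2 * i - 1) = u (2 * i - 1) :=
  C.mix_of_not_mem (C.odd_not_mem_I (by omega) (by omega) (by omega))
    (by rwa [show 2 * i - 1 - 1 = 2 * i - 2 by omega]) u

theorem calcLeft_L (hi : i ≤ 2 ^ l) (hp : C.Entry ω (d + 1) l i p)
    (hI : 2 * (i - 1) ∉ C.I (l + 1)) :
    C.LCorrect ω d (l + 1) (2 * i - 1) (C.calcLeft l i (2 ^ d) p) := by
  intro β hβ hβ'
  simp only [calcLeft, update_self]
  split_ifs with hs
  · obtain ⟨hi', hs⟩ := hs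
    have hc : C.lastChild l (i - 1) = 2 * i - 2 := by rw [C.lastChild_of_not_mem hI]; omega
    obtain ⟨hB, hR, -, -⟩ := hp.leftover hi'
    rw [hc] at hB hR
    -- The previous node left the LLR of this entry for both values of its predecessor. Reading it
    -- at the decoded bit makes the update in `RCorrect` trivial.
    rw [hB β hβ hβ', hR hs β hβ hβ', update_eq_self, show 2 * i - 2 + 1 = 2 * i - 1 by omega]
  · rw [hp.L.left hβ hβ', hp.L.right hβ hβ', llrAt_succ, C.llr_nodeScore_first (by omega)
      (C.localTo_score ω (by omega) _ _) (C.localTo_score ω (by omega) _ _) h1 hi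
      (by rwa [show 2 * i - 2 = 2 * (i - 1) by omega])]

theorem calcLeft_R (hi : i ≤ 2 ^ l) (hp : C.Entry ω (d + 1) l i p)
    (hI : 2 * (i - 1) ∉ C.I (l + 1)) (hs : ¬ C.RightSeparated (l + 1) (2 * i - 1)) :
    C.RCorrect ω d (l + 1) (2 * i - 1) (C.calcLeft l i (2 ^ d) p) := by
  intro β hβ hβ' b
  have hI' : 2 * i - 2 ∉ C.I (l + 1) := by rwa [show 2 * i - 2 = 2 * (i - 1) by omega]
  simp only [calcLeft, if_neg hs, update_self]
  rw [show 2 * i - 1 + 1 = 2 * i by omega]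
  have := secondLLR_correct hm h1 hi hp.L hp.R hβ hβ'
    (w := update (C.bit d (l + 1) p.u β) (2 * i - 1) b)
    (C.agreeTo_mix (by omega) (by omega) hI' (agreeTo_update (by omega) _ _))
  rwa [odd_pred_eq hm h1 hI', update_self] at this

theorem calcLeft_M (hp : C.Entry ω (d + 1) l i p) (hs : ¬ C.RightSeparated (l + 1) (2 * i - 1))
    (hI : 2 * i ∈ C.I (l + 1)) {β : ℕ} (hβ : 1 ≤ β) (hβ' : β ≤ 2 ^ d) (b c : ZMod 2) :
    (C.calcLeft l i (2 ^ d) p).M l β b c = C.llrAt ω d (l + 1) β (2 * i + 1)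
      (update (update (C.bit d (l + 1) p.u β) (2 * i - 1) b) (2 * i) c) := by
  have := interLLR_correct hm h1 hI hp.L (hp.R (not_rightSeparated_of_mem hm hI)) hβ hβ'
    (w := update (update (C.bit d (l + 1) p.u β) (2 * i - 1) b) (2 * i) c)
    ((agreeTo_update (by omega) _ _).trans (agreeTo_update (by omega) _ _))
  rw [update_self, update_of_ne (by omega), update_self] at this
  simpa [calcLeft, hs, hI] using this

omit hm in
theorem lastLeaf_pred (hI : 2 * (i - 1) ∉ C.I (l + 1)) :
    C.lastLeaf (d + 1) l (i - 1) = C.lastLeaf d (l + 1) (2 * i - 1 - 1) := by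
  rw [lastLeaf, C.lastChild_of_not_mem hI]; congr 1; omega

theorem entry_calcLeft (hi : i ≤ 2 ^ l) (hp : C.Entry ω (d + 1) l i p)
    (hI : 2 * (i - 1) ∉ C.I (l + 1)) :
    C.Entry ω d (l + 1) (2 * i - 1) (C.calcLeft l i (2 ^ d) p) where
  L := calcLeft_L hm h1 hi hp hI
  R := calcLeft_R hm h1 hi hp hI
  leftover hi' := by
    have h := (hp.leftover (by omega)).2.2.2
    have hc : C.lastChild l (i - 1) = 2 * i - 1 - 1 := by rw [C.lastChild_of_not_mem hI]; omega
    rw [hc] at h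
    refine h.transfer (by omega) (by omega) (fun _ _ => rfl) (fun k hk => ?_) (fun _ _ => rfl)
      (agreeTo_refl _ _)
    simp only [calcLeft]; split_ifs
    · rfl
    · exact update_of_ne (by omega) _ _
  metric := by rw [← lastLeaf_pred h1 hI]; exact hp.metric

theorem middle_saveFirst (hi : i ≤ 2 ^ l) (hp : C.Entry ω (d + 1) l i p)
    (hI : 2 * (i - 1) ∉ C.I (l + 1))
    (hq : C.Exit ω d (l + 1) (2 * i - 1) (C.calcLeft l i (2 ^ d) p) q) :
    C.Middle ω d l i (saveFirst l (2 ^ d) q) ∧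
      Kept l (C.lastLeaf (d + 1) l (i - 1)) p (saveFirst l (2 ^ d) q) := by
  have hI' : 2 * i - 2 ∉ C.I (l + 1) := by rwa [show 2 * i - 2 = 2 * (i - 1) by omega]
  have hk : Kept l (C.lastLeaf (d + 1) l (i - 1)) p (saveFirst l (2 ^ d) q) :=
    ((C.kept_calcLeft _ _ _ _ _).trans (hq.kept.mono (by omega)
      (lastLeaf_pred h1 hI).le)).trans (kept_saveFirst _ _ _ _)
  refine ⟨?_, hk⟩
  have hu : AgreeTo (C.lastLeaf d (l + 1) (2 * i - 1 - 1)) q.u p.u := hq.kept.u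
  refine ⟨hp.L.transfer (by omega) h1 (hk.L _ le_rfl) hk.u,
    fun hs => (hp.R hs).transfer (by omega) h1 (hk.R _ le_rfl) hk.u, fun β hβ hβ' => ?_,
    fun β hβ hβ' => ?_, fun hs => ?_, fun hs hI2 β hβ hβ' b c => ?_, ?_, hq.metric⟩
  · rw [odd_pred_eq hm h1 hI']
    simp only [saveFirst, update_self, if_pos hβ']
    exact hq.B β hβ hβ'
  · simp only [saveFirst]
    rw [update_of_ne (by omega)]
    exact hq.B β hβ hβ'
  · exact (calcLeft_R hm h1 hi hp hI hs).transfer (by omega) (by omega) (hq.kept.R _ le_rfl) hu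
  -- The table was written before the child call; the child changes `M` only from layer `l + 1` on.
  · have hM : (saveFirst l (2 ^ d) q).M l = (C.calcLeft l i (2 ^ d) p).M l := hq.kept.M l (by omega)
    rw [hM, calcLeft_M hm h1 hp hs hI2 hβ hβ']
    refine llr_congr (C.localTo_score ω (by omega) _ _) (by omega) ?_
    have := (C.agreeTo_bit (by omega) hu β).symm
    have := (this.update_at (by omega) b).update_at (n := 2 * i - 1 + 1) (by omega) c
    rwa [show 2 * i - 1 + 1 = 2 * i by omega] at this
  · refine hq.leftover.transfer (by omega) (by omega) (fun k hk => ?_) (fun _ _ => rfl)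
      (fun _ _ => rfl) (agreeTo_refl _ _)
    exact update_of_ne (by omega) _ _

/-- Entry `2 * i - 1` was already decoded as the third child of node `i - 1`, and its transformed
value waits in `H`. The gap condition excludes a second pair at `2 * i`, so no table `M` is needed.
-/
theorem middle_restoreFirst (hp : C.Entry ω (d + 1) l i p)
    (hI : 2 * (i - 1) ∈ C.I (l + 1)) :
    C.Middle ω d l i (restoreFirst l (2 ^ d) p) ∧
      Kept l (C.lastLeaf (d + 1) l (i - 1)) p (restoreFirst l (2 ^ d) p) := by
  have hi : 1 < i := by
    by_contra hcon
    rw [show 2 * (i - 1) = 0 by omega] at hI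
    exact C.zero_not_mem_I (by omega) (by omega) hI
  have hnot : 2 * i ∉ C.I (l + 1) := by
    have := C.add_two_not_mem_I (by omega) (by omega) hI
    rwa [show 2 * (i - 1) + 2 = 2 * i by omega] at this
  have hk := kept_restoreFirst l (2 ^ d) (C.lastLeaf (d + 1) l (i - 1)) p
  obtain ⟨hB, hR, hH, hleft⟩ := hp.leftover hi
  have hc : C.lastChild l (i - 1) = 2 * i - 1 := by rw [C.lastChild_of_mem hI]; omega
  rw [hc] at hB hR hleft
  refine ⟨⟨hp.L, hp.R, fun β hβ hβ' => ?_, fun β hβ hβ' => ?_, hR, fun _ h => absurd h hnot, ?_,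
    ?_⟩, hk⟩
  · simp only [restoreFirst, update_self, if_pos hβ']
    rw [hH hI β hβ hβ', show 2 * (i - 1) + 1 = 2 * i - 1 by omega]
  · simp only [restoreFirst]
    rw [update_of_ne (by omega)]
    exact hB β hβ hβ'
  · refine hleft.transfer (by omega) (by omega) (fun k hk => ?_) (fun _ _ => rfl)
      (fun _ _ => rfl) (agreeTo_refl _ _)
    exact update_of_ne (by omega) _ _
  · have := hp.metric
    rwa [lastLeaf, hc] at this

/-- Either the table was filled for both first bits before the first child, or it is filled now for
the decoded first bit only. Only that row is ever read. -/
theorem calcMiddle_M (hp : C.Middle ω d l i p) (hI : 2 * i ∈ C.I (l + 1)) {β : ℕ} (hβ : 1 ≤ β)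
    (hβ' : β ≤ 2 ^ d) (c : ZMod 2) :
    (C.calcMiddle l i (2 ^ d) p).M l β (p.B l β) c = C.llrAt ω d (l + 1) β (2 * i + 1)
      (update (C.bit d (l + 1) p.u β) (2 * i) c) := by
  have hI' : 2 * i - 2 ∉ C.I (l + 1) := C.sub_two_not_mem_I (by omega) (by omega) hI
  have hB : p.B l β = C.bit d (l + 1) p.u β (2 * i - 1) := by
    rw [hp.B β hβ hβ', odd_pred_eq hm h1 hI']
  by_cases hs : C.RightSeparated (l + 1) (2 * i - 1)
  · have := interLLR_correct hm h1 hI hp.L (hp.R (not_rightSeparated_of_mem hm hI)) hβ hβ'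
      (w := update (C.bit d (l + 1) p.u β) (2 * i) c) (agreeTo_update (by omega) _ _)
    rw [update_self, update_of_ne (by omega), ← hB] at this
    simpa [calcMiddle, calcMiddleLR, calcMiddleM, hs, hI] using this
  · have := hp.M hs hI β hβ hβ' (p.B l β) c
    rw [hB, update_eq_self] at this
    rw [hB]
    simpa [calcMiddle, calcMiddleLR, calcMiddleM, hs] using this

theorem entry_calcMiddle (hi : i ≤ 2 ^ l) (hp : C.Middle ω d l i p) :
    C.Entry ω d (l + 1) (2 * i) (C.calcMiddle l i (2 ^ d) p) where
  L := by
    intro β hβ hβ'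
    have hu : (C.calcMiddle l i (2 ^ d) p).u = p.u := rfl
    have hL : (C.calcMiddle l i (2 ^ d) p).L (l + 1) β =
        if ¬ C.RightSeparated (l + 1) (2 * i - 1) then p.R (l + 1) β (p.B (l + 1) β)
        else C.secondLLR p l i (2 ^ d) β (p.B l β) := by
      simp only [calcMiddle, calcMiddleLR, update_self]; rfl
    rw [hL, hu]
    split_ifs with hs
    · rw [hp.B β hβ hβ']
      exact secondLLR_correct hm h1 hi hp.L hp.R hβ hβ' (agreeTo_refl _ _)
    · rw [hp.B' β hβ hβ', hp.R' hs β hβ hβ', update_eq_self, show 2 * i - 1 + 1 = 2 * i by omega]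
  R hs := by
    intro β hβ hβ' b
    have hu : (C.calcMiddle l i (2 ^ d) p).u = p.u := rfl
    have hR : (C.calcMiddle l i (2 ^ d) p).R (l + 1) β b =
        if 2 * i ∉ C.I (l + 1) then condLLR p l (2 ^ d) β (p.B l β) b
        else (C.calcMiddle l i (2 ^ d) p).M l β (p.B l β) b := by
      simp only [calcMiddle, calcMiddleLR, if_neg hs, update_self]; rfl
    rw [hR, hu]
    split_ifs with hI
    · exact calcMiddle_M hm h1 hp hI hβ hβ' b
    -- Separation passes from a node to its child `2 * i`, so this child needs conditional LLRs only
    -- if the parent has them.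
    · have hs' : ¬ C.RightSeparated l i := fun h => hs h.child
      have hodd : 2 * i - 1 ∉ C.I (l + 1) := C.odd_not_mem_I (by omega) (by omega) (by omega)
      have hmix := C.mix_update (by omega) (by omega) (by omega) hI hodd
        (C.bit d (l + 1) p.u β) b
      rw [llrAt_succ, C.llr_nodeScore_cond (by omega)
        (C.localTo_score ω (by omega) _ _) (C.localTo_score ω (by omega) _ _) h1
        (lt_of_not_rightSeparated hs') hI
        (v := C.mix (l + 1) (C.bit d (l + 1) p.u β))
        ((hmix.mono (by omega)).trans (agreeTo_update (by omega) _ _)),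
        hmix _ (by omega) (by omega), hmix _ (by omega) le_rfl, update_self,
        update_of_ne (by omega), ← hp.B β hβ hβ', ← (hp.R hs').left hβ hβ',
        ← (hp.R hs').right hβ hβ']
      rfl
  leftover _ := by
    refine hp.leftover.transfer (by omega) (by omega) (fun _ _ => rfl) (fun k hk => ?_)
      (fun _ _ => rfl) (agreeTo_refl _ _)
    simp only [calcMiddle, calcMiddleLR]; split_ifs
    · rfl
    all_goals exact update_of_ne (by omega) _ _
  metric := hp.metric

end Steps

/-! ### Completing a node with two or three children -/

section Finish

variable {C : Code m} {ω : ℕ → ZMod 2 → ℝ} {d l i : ℕ} {p q r : Path}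
variable (hm : l + (d + 1) = m) (h1 : 1 ≤ i)

include h1 in
theorem lastLeaf_le_first (C : Code m) (d l : ℕ) :
    C.lastLeaf (d + 1) l (i - 1) ≤ C.lastLeaf d (l + 1) (2 * i - 1) := by
  have h : C.lastChild l (i - 1) ≤ 2 * i - 1 := by
    have := C.lastChild_le l (i - 1); omega
  exact C.lastLeaf_mono d (l + 1) h

include h1 in
theorem kept_second (hq : C.Exit ω d (l + 1) (2 * i) (C.calcMiddle l i (2 ^ d) p) q) :
    Kept l (C.lastLeaf (d + 1) l (i - 1)) p q :=
  (C.kept_calcMiddle _ _ _ _ _).trans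
    (hq.kept.mono (by omega) (lastLeaf_le_first h1 C d l))

include hm h1

/-- The first bits of the node after the child `2 * i`. -/
theorem first_bits (hp : C.Middle ω d l i p)
    (hq : C.Exit ω d (l + 1) (2 * i) (C.calcMiddle l i (2 ^ d) p) q) {β : ℕ} (hβ : 1 ≤ β)
    (hβ' : β ≤ 2 ^ d) :
    q.B l β = p.B l β ∧ q.B l β = C.mix (l + 1) (C.bit d (l + 1) q.u β) (2 * i - 1) := by
  have hB : q.B l = p.B l := hq.kept.B l (by omega)
  have hu : AgreeTo (C.lastLeaf d (l + 1) (2 * i - 1)) q.u p.u := hq.kept.u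
  refine ⟨congrFun hB β, ?_⟩
  rw [hB, hp.B β hβ hβ']
  exact (C.agreeTo_mix (by omega) (by omega) (C.odd_not_mem_I (by omega) (by omega) (by omega))
      (C.agreeTo_bit (by omega) hu β) (2 * i - 1) (by omega) le_rfl).symm

theorem rCorrect_second (hi : i ≤ 2 ^ l) (hp : C.Middle ω d l i p)
    (hq : C.Exit ω d (l + 1) (2 * i) (C.calcMiddle l i (2 ^ d) p) q)
    (hs : ¬ C.RightSeparated (l + 1) (2 * i)) : C.RCorrect ω d (l + 1) (2 * i) q :=
  ((entry_calcMiddle hm h1 hi hp).R hs).transfer (by omega) (by omega) (hq.kept.R _ le_rfl)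
    hq.kept.u

theorem exit_combineTwo (hi : i ≤ 2 ^ l) (hI : 2 * i ∉ C.I (l + 1)) (hp : C.Middle ω d l i p)
    (hq : C.Exit ω d (l + 1) (2 * i) (C.calcMiddle l i (2 ^ d) p) q) :
    C.Exit ω (d + 1) l i p (combineTwo l (2 ^ d) q) where
  kept := (kept_second h1 hq).trans (kept_combineTwo _ _ _ _)
  B β hβ hβ' := by
    have hodd : 2 * i - 1 ∉ C.I (l + 1) := C.odd_not_mem_I (by omega) (by omega) (by omega)
    have hsec : ∀ β, 1 ≤ β → β ≤ 2 ^ d → q.B (l + 1) β =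
        C.mix (l + 1) (C.bit d (l + 1) q.u β) (2 * i) := fun β h h' => by
      rw [C.mix_of_not_mem hI hodd]; exact hq.B β h h'
    rw [pow_succ] at hβ'
    simp only [combineTwo, update_self, bit]
    split_ifs with h
    · rw [(first_bits hm h1 hp hq hβ h).2, hsec β hβ h]; rfl
    · rw [hsec (β - 2 ^ d) (by omega) (by omega)]; rfl
  leftover := by
    have hne : ∀ k > l, (combineTwo l (2 ^ d) q).B k = q.B k := fun k hk =>
      update_of_ne (by omega) _ _
    unfold Leftover
    rw [C.lastChild_of_not_mem hI]
    refine ⟨hq.B.transfer (by omega) (by omega) (hne _ (by omega)) (agreeTo_refl _ _),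
      fun hs => (rCorrect_second hm h1 hi hp hq hs).transfer (by omega) (by omega) rfl
        (agreeTo_refl _ _), fun h => absurd h hI,
      hq.leftover.transfer (by omega) (by omega) (fun k hk => hne k (by omega)) (fun _ _ => rfl)
        (fun _ _ => rfl) (agreeTo_refl _ _)⟩
  metric := by
    rw [lastLeaf, C.lastChild_of_not_mem hI]; exact hq.metric

/-- The path on which the child `2 * i + 1` is entered. -/
theorem entry_calcRight (hI : 2 * i ∈ C.I (l + 1)) (hp : C.Middle ω d l i p)
    (hq : C.Exit ω d (l + 1) (2 * i) (C.calcMiddle l i (2 ^ d) p) q) :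
    C.Entry ω d (l + 1) (2 * i + 1) (C.calcRight l i (2 ^ d) (saveSecond l (2 ^ d) q)) := by
  have hI' : 2 * i - 2 ∉ C.I (l + 1) := C.sub_two_not_mem_I (by omega) (by omega) hI
  have hs' := not_rightSeparated_of_mem hm hI
  have hu : AgreeTo (C.lastLeaf d (l + 1) (2 * i - 1)) q.u p.u := hq.kept.u
  have hk := kept_second h1 hq
  have hB1 : ∀ β, 1 ≤ β → β ≤ 2 ^ d → (saveSecond l (2 ^ d) q).B l β =
      C.bit d (l + 1) q.u β (2 * i - 1) := fun β hβ hβ' => by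
    rw [← odd_pred_eq hm h1 hI' (C.bit _ _ _ _), ← (first_bits hm h1 hp hq hβ hβ').2]
    simp [saveSecond, hβ']
  have hB2 : ∀ β, 1 ≤ β → β ≤ 2 ^ d → (saveSecond l (2 ^ d) q).B l (β + 2 ^ d) =
      C.bit d (l + 1) q.u β (2 * i) := fun β hβ hβ' => by
    rw [← hq.B β hβ hβ']
    simp [saveSecond, show β ≠ 0 by omega]
  constructor
  · intro β hβ hβ'
    have hL : (C.calcRight l i (2 ^ d) (saveSecond l (2 ^ d) q)).L (l + 1) β =
        q.M l β ((saveSecond l (2 ^ d) q).B l β) ((saveSecond l (2 ^ d) q).B l (β + 2 ^ d)) := by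
      simp only [calcRight, update_self]; rfl
    have hM : q.M l = (C.calcMiddle l i (2 ^ d) p).M l := hq.kept.M l (by omega)
    have hBp : (saveSecond l (2 ^ d) q).B l β = p.B l β := by
      rw [← (first_bits hm h1 hp hq hβ hβ').1]; simp [saveSecond, hβ']
    rw [hL, hM, hBp, calcMiddle_M hm h1 hp hI hβ hβ', hB2 β hβ hβ']
    refine llr_congr (C.localTo_score ω (by omega) _ _) (by omega) ?_
    have hagree := (C.agreeTo_bit (by omega) hu β).symm
    exact (hagree.update_at (by omega) _).trans (agreeTo_update_self _ rfl)
  · intro hs β hβ hβ' b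
    have hR : C.RCorrect ω (d + 1) l i q :=
      (hp.R hs').transfer (by omega) h1 (hk.R _ le_rfl) hk.u
    have hR' : (C.calcRight l i (2 ^ d) (saveSecond l (2 ^ d) q)).R (l + 1) β b =
        if 2 * i ∈ C.S (l + 1) then
          fPlus (q.R l β (C.bit d (l + 1) q.u β (2 * i - 1) + b)) (q.R l (β + 2 ^ d) b)
            (C.bit d (l + 1) q.u β (2 * i))
        else
          fPlus (q.R l β (C.bit d (l + 1) q.u β (2 * i - 1) +
            C.bit d (l + 1) q.u β (2 * i) + b))
            (q.R l (β + 2 ^ d) (C.bit d (l + 1) q.u β (2 * i) + b)) b := by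
      rw [← hB1 β hβ hβ', ← hB2 β hβ hβ']
      simp only [calcRight, if_neg hs, update_self]; rfl
    have hw : AgreeTo (2 * i - 2)
        (C.mix (l + 1) (update (C.bit d (l + 1) q.u β) (2 * i + 1) b))
        (C.mix (l + 1) (C.bit d (l + 1) q.u β)) :=
      C.agreeTo_mix (by omega) (by omega) hI' (agreeTo_update (by omega) _ _)
    rw [hR', llrAt_succ]
    change _ = llr _ _ (2 * i + 2) (update (C.bit d (l + 1) q.u β) (2 * i + 1) b)
    rw [C.llr_nodeScore_fourth (by omega) (C.localTo_score ω (by omega) _ _)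
      (C.localTo_score ω (by omega) _ _) h1 (lt_of_not_rightSeparated hs') hI hw,
      ← hR.left hβ hβ', ← hR.right hβ hβ', update_of_ne (by omega)]
    by_cases hS : 2 * i ∈ C.S (l + 1)
    · rw [if_pos hS, C.mix_swap hS, C.mix_swap_succ (by omega) (by omega) hS, update_self,
        update_of_ne (by omega)]
    · have hA := mem_A_of_mem_I hI hS
      rw [if_neg hS, C.mix_add (by omega) (by omega) hA, C.mix_add_succ (by omega) (by omega) hA,
        update_self, update_of_ne (by omega), add_assoc]
  · intro _
    refine hq.leftover.transfer (by omega) (by omega) (fun k hk => ?_) (fun k hk => ?_)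
      (fun _ _ => rfl) (agreeTo_refl _ _)
    · exact update_of_ne (by omega) _ _
    · simp only [calcRight]; split_ifs
      · rfl
      all_goals exact update_of_ne (by omega) _ _
  · exact hq.metric

/-- The third child already belongs to the next node's pair. Its transformed value, `r₂` for a swap
and `r₃` for an addition, is the first vector of that node, which is why it is kept in `H`. -/
theorem exit_combineThree (hI : 2 * i ∈ C.I (l + 1)) (hp : C.Middle ω d l i p)
    (hq : C.Exit ω d (l + 1) (2 * i) (C.calcMiddle l i (2 ^ d) p) q)
    (hr : C.Exit ω d (l + 1) (2 * i + 1) (C.calcRight l i (2 ^ d) (saveSecond l (2 ^ d) q)) r) :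
    C.Exit ω (d + 1) l i p (C.combineThree l i (2 ^ d) r) := by
  have hI' : 2 * i - 2 ∉ C.I (l + 1) := C.sub_two_not_mem_I (by omega) (by omega) hI
  have hu : AgreeTo (C.lastLeaf d (l + 1) (2 * i)) r.u q.u := hr.kept.u
  have hbit : ∀ β k, 1 ≤ k → k ≤ 2 * i → C.bit d (l + 1) q.u β k = C.bit d (l + 1) r.u β k :=
    fun β k hk hk' => (C.agreeTo_bit (by omega) hu β k hk hk').symm
  have hBr : r.B l = (saveSecond l (2 ^ d) q).B l := hr.kept.B l (by omega)
  have hB1 : ∀ β, 1 ≤ β → β ≤ 2 ^ d → r.B l β = C.mix (l + 1) (C.bit d (l + 1) r.u β) (2 * i - 1) :=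
    fun β hβ hβ' => by
    rw [hBr, odd_pred_eq hm h1 hI', ← hbit β _ (by omega) (by omega),
      ← odd_pred_eq hm h1 hI' (C.bit d (l + 1) q.u β),
      ← (first_bits hm h1 hp hq hβ hβ').2]
    simp [saveSecond, hβ']
  have hB2 : ∀ β, 1 ≤ β → β ≤ 2 ^ d → r.B l (β + 2 ^ d) = C.bit d (l + 1) r.u β (2 * i) :=
    fun β hβ hβ' => by
    rw [hBr, ← hbit β _ (by omega) le_rfl, ← hq.B β hβ hβ']
    simp [saveSecond, show β ≠ 0 by omega]
  have hB3 : ∀ β, 1 ≤ β → β ≤ 2 ^ d → r.B (l + 1) β = C.bit d (l + 1) r.u β (2 * i + 1) := hr.B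
  have hk : Kept l (C.lastLeaf (d + 1) l (i - 1)) p (C.combineThree l i (2 ^ d) r) :=
    (((kept_second h1 hq).trans (kept_saveSecond _ _ _ _)).trans (C.kept_calcRight _ _ _ _ _)).trans
      ((hr.kept.mono (by omega) ((lastLeaf_le_first h1 C d l).trans
        (C.lastLeaf_mono _ _ (by omega)))).trans (C.kept_combineThree _ _ _ _ _))
  have hru := C.combineThree_u l i (2 ^ d) r
  have hne : ∀ k > l, (C.combineThree l i (2 ^ d) r).B k = r.B k := fun k hk => by
    unfold combineThree; split_ifs <;> exact update_of_ne (by omega) _ _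
  have hneH : ∀ k > l, (C.combineThree l i (2 ^ d) r).H k = r.H k := fun k hk => by
    unfold combineThree; split_ifs <;> exact update_of_ne (by omega) _ _
  have hR : (C.combineThree l i (2 ^ d) r).R = r.R := by unfold combineThree; split_ifs <;> rfl
  have hpm : (C.combineThree l i (2 ^ d) r).pm = r.pm := by unfold combineThree; split_ifs <;> rfl
  refine ⟨hk, fun β hβ hβ' => ?_, ?_, ?_⟩
  · rw [pow_succ] at hβ'
    rw [hru]
    unfold combineThree
    by_cases hS : 2 * i ∈ C.S (l + 1)
    · rw [if_pos hS]
      simp only [update_self, bit]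
      split_ifs with h
      · rw [hB1 β hβ h, hB3 β hβ h, upper, C.mix_swap hS]
      · rw [hB3 _ (by omega) (by omega), lower, C.mix_swap hS]
    · have hA := mem_A_of_mem_I hI hS
      rw [if_neg hS]
      simp only [update_self, bit]
      split_ifs with h
      · rw [hB1 β hβ h, hB2 β hβ h, hB3 β hβ h, upper, C.mix_add (by omega) (by omega) hA, add_assoc]
      · have := hB2 (β - 2 ^ d) (by omega) (by omega)
        rw [show β - 2 ^ d + 2 ^ d = β by omega] at this
        rw [this, hB3 _ (by omega) (by omega), lower, C.mix_add (by omega) (by omega) hA]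
  · unfold Leftover
    rw [C.lastChild_of_mem hI]
    have hu' : ∀ n, AgreeTo n (C.combineThree l i (2 ^ d) r).u r.u := fun n => by
      rw [hru]; exact agreeTo_refl _ _
    refine ⟨hr.B.transfer (by omega) (by omega) (hne _ (by omega)) (hu' _), fun hs => ?_,
      fun _ β hβ hβ' => ?_, hr.leftover.transfer (by omega) (by omega)
        (fun k hk => hne k (by omega)) (fun _ _ => by rw [hR]) (fun k hk => hneH k (by omega))
        (hu' _)⟩
    · have hr' : C.RCorrect ω d (l + 1) (2 * i + 1) r :=
        ((entry_calcRight hm h1 hI hp hq).R hs).transfer (by omega) (by omega)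
          (hr.kept.R _ le_rfl) hr.kept.u
      exact hr'.transfer (by omega) (by omega) (by rw [hR]) (hu' _)
    · rw [hru]
      unfold combineThree
      by_cases hS : 2 * i ∈ C.S (l + 1)
      · rw [if_pos hS, C.mix_swap_succ (by omega) (by omega) hS, ← hB2 β hβ hβ']
        simp
      · rw [if_neg hS, C.mix_add_succ (by omega) (by omega) (mem_A_of_mem_I hI hS), ← hB3 β hβ hβ']
        simp
  · have := hr.metric
    unfold MetricCorrect at this ⊢
    rw [lastLeaf, C.lastChild_of_mem hI, hru, hpm]
    exact this

end Finish

/-! ### Leaves and induction over the recursion tree -/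

theorem prune_top (ps : List Path) : prune ⊤ ps = ps := by simp [prune]

/-- The telescoping step: `best` before the decision is the maximum of its two continuations, so the
penalty is exactly the loss in `best`. The term for the empty prefix does not depend on the path. -/
theorem exit_extend {C : Code m} {ω : ℕ → ZMod 2 → ℝ} {i : ℕ} (h1 : 1 ≤ i) (hi : i ≤ 2 ^ m)
    {p : Path} (hp : C.Entry ω 0 m i p) (b : ZMod 2) :
    C.Exit ω 0 m i p (extend m i p b) where
  kept := by
    refine ⟨agreeTo_update (by simp only [lastLeaf]; omega) _ _, fun _ _ => rfl, fun _ _ => rfl,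
      fun k hk => update_of_ne (by omega) _ _, fun _ _ => rfl, fun _ _ => rfl⟩
  B β hβ hβ' := by
    obtain rfl : β = 1 := by simp at hβ'; omega
    simp [extend, bit]
  leftover := trivial
  metric := by
    have h := hp.metric
    have hL := hp.L 1 le_rfl (by simp)
    have hloc := C.localTo_score ω le_rfl (2 ^ 0) 1
    simp only [MetricCorrect, lastLeaf] at h ⊢
    rw [best_of_lt (by omega : i - 1 < 2 ^ m), Nat.sub_add_cancel h1] at h
    simp only [llrAt, bit, llr] at hL
    simp only [extend, hL]
    rw [penalty_sub (fun b => best (2 ^ m) (C.score ω m (2 ^ 0) 1) i (update p.u i b)), h,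
      best_congr hloc (agreeTo_update h1 p.u b : AgreeTo 0 _ _)]
    ring

/-- Without pruning, paths do not interact, so each outgoing path can be traced back through the
children to one incoming path. The one-path lemmas above are then chained along this history. -/
theorem exists_exit_of_mem_decodeNode (C : Code m) (ω : ℕ → ZMod 2 → ℝ) (d : ℕ) {l i : ℕ}
    (hm : l + d = m) (h1 : 1 ≤ i) (hi : i ≤ 2 ^ l) {ps : List Path}
    (hps : ∀ p ∈ ps, C.Entry ω d l i p) {q : Path} (hq : q ∈ C.decodeNode ⊤ d l i ps) :
    ∃ p ∈ ps, C.Exit ω d l i p q := by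
  induction d generalizing l i ps q with
  | zero =>
    obtain rfl : l = m := by omega
    simp only [decodeNode, decodeLeaf, prune_top, List.mem_flatMap] at hq
    obtain ⟨p, hp, hq⟩ := hq
    refine ⟨p, hp, ?_⟩
    obtain ⟨b, rfl⟩ : ∃ b, q = extend l i p b := by
      split_ifs at hq
      · exact ⟨0, by simpa using hq⟩
      · simp only [List.mem_cons, List.not_mem_nil, or_false] at hq
        exact hq.elim (fun h => ⟨0, h⟩) fun h => ⟨1, h⟩
    exact exit_extend h1 hi (hps p hp) b
  | succ d ih =>
    have hpow : 2 ^ (l + 1) = 2 * 2 ^ l := pow_succ' _ _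
    have first : ∀ p₁ ∈ (if 2 * (i - 1) ∉ C.I (l + 1) then
        (C.decodeNode ⊤ d (l + 1) (2 * i - 1) (ps.map (C.calcLeft l i (2 ^ d)))).map
          (saveFirst l (2 ^ d))
        else ps.map (restoreFirst l (2 ^ d))), ∃ p ∈ ps, C.Middle ω d l i p₁ ∧
          Kept l (C.lastLeaf (d + 1) l (i - 1)) p p₁ := by
      intro p₁ hp₁
      by_cases hI : 2 * (i - 1) ∈ C.I (l + 1)
      · rw [if_neg (not_not.2 hI), List.mem_map] at hp₁
        obtain ⟨p, hp, rfl⟩ := hp₁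
        exact ⟨p, hp, middle_restoreFirst hm h1 (hps p hp) hI⟩
      · rw [if_pos hI, List.mem_map] at hp₁
        obtain ⟨r, hr, rfl⟩ := hp₁
        obtain ⟨p', hp', hr⟩ := ih (by omega) (by omega) (by omega) (fun p' hp' => by
          obtain ⟨p, hp, rfl⟩ := List.mem_map.1 hp'
          exact entry_calcLeft hm h1 hi (hps p hp) hI) hr
        obtain ⟨p, hp, rfl⟩ := List.mem_map.1 hp'
        exact ⟨p, hp, middle_saveFirst hm h1 hi (hps p hp) hI hr⟩
    simp only [decodeNode] at hq
    revert hq first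
    generalize (if 2 * (i - 1) ∉ C.I (l + 1) then
        (C.decodeNode ⊤ d (l + 1) (2 * i - 1) (ps.map (C.calcLeft l i (2 ^ d)))).map
          (saveFirst l (2 ^ d))
        else ps.map (restoreFirst l (2 ^ d))) = ps₁
    intro hq first
    have second : ∀ p₂ ∈ C.decodeNode ⊤ d (l + 1) (2 * i) (ps₁.map (C.calcMiddle l i (2 ^ d))),
        ∃ p₁ ∈ ps₁, C.Exit ω d (l + 1) (2 * i) (C.calcMiddle l i (2 ^ d) p₁) p₂ := by
      intro p₂ hp₂
      obtain ⟨p', hp', h⟩ := ih (by omega) (by omega) (by omega) (fun p' hp' => by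
        obtain ⟨p₁, hp₁, rfl⟩ := List.mem_map.1 hp'
        obtain ⟨p, hp, hmid, -⟩ := first p₁ hp₁
        exact entry_calcMiddle hm h1 hi hmid) hp₂
      obtain ⟨p₁, hp₁, rfl⟩ := List.mem_map.1 hp'
      exact ⟨p₁, hp₁, h⟩
    have glue : ∀ {p p₁ q}, Kept l (C.lastLeaf (d + 1) l (i - 1)) p p₁ →
        C.Exit ω (d + 1) l i p₁ q → C.Exit ω (d + 1) l i p q := fun hk hx =>
      ⟨hk.trans hx.kept, hx.B, hx.leftover, hx.metric⟩
    by_cases hI : 2 * i ∈ C.I (l + 1)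
    · rw [if_neg (not_not.2 hI), List.mem_map] at hq
      obtain ⟨r, hr, rfl⟩ := hq
      have hi' := (C.pos_of_mem_I (by omega) (by omega) hI).2
      obtain ⟨p', hp', hr⟩ := ih (by omega) (by omega) hi' (fun p' hp' => by
        rw [List.map_map] at hp'
        obtain ⟨p₂, hp₂, rfl⟩ := List.mem_map.1 hp'
        obtain ⟨p₁, hp₁, hx⟩ := second p₂ hp₂
        obtain ⟨p, hp, hmid, -⟩ := first p₁ hp₁
        exact entry_calcRight hm h1 hI hmid hx) hr
      rw [List.map_map] at hp'
      obtain ⟨p₂, hp₂, rfl⟩ := List.mem_map.1 hp'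
      obtain ⟨p₁, hp₁, hx⟩ := second p₂ hp₂
      obtain ⟨p, hp, hmid, hk⟩ := first p₁ hp₁
      exact ⟨p, hp, glue hk (exit_combineThree hm h1 hI hmid hx hr)⟩
    · rw [if_pos hI, List.mem_map] at hq
      obtain ⟨p₂, hp₂, rfl⟩ := hq
      obtain ⟨p₁, hp₁, hx⟩ := second p₂ hp₂
      obtain ⟨p, hp, hmid, hk⟩ := first p₁ hp₁
      exact ⟨p, hp, glue hk (exit_combineTwo hm h1 hi hI hmid hx)⟩

/-! ### The decision vectors of the paths -/

section Decisions

variable (C : Code m)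

/-- The decision vectors after `n` message bits, in the order of the list of paths. -/
def decisions : ℕ → List (ℕ → ZMod 2)
  | 0 => [0]
  | n + 1 => (decisions n).flatMap fun u =>
      if n + 1 ∈ C.frozen then [update u (n + 1) 0]
      else [update u (n + 1) 0, update u (n + 1) 1]

theorem exists_of_mem_decisions_succ {n : ℕ} {u w : ℕ → ZMod 2}
    (h : w ∈ if n + 1 ∈ C.frozen then [update u (n + 1) 0]
      else [update u (n + 1) 0, update u (n + 1) 1]) :
    ∃ b, w = update u (n + 1) b ∧ (n + 1 ∈ C.frozen → b = 0) := by
  split_ifs at h with hf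
  · exact ⟨0, by simpa using h, fun _ => rfl⟩
  · simp only [List.mem_cons, List.not_mem_nil, or_false] at h
    exact h.elim (fun h => ⟨0, h, fun _ => rfl⟩) fun h => ⟨1, h, fun h' => absurd h' hf⟩

theorem mem_decisions {n : ℕ} {w : ℕ → ZMod 2} :
    w ∈ C.decisions n ↔ (∀ j, j = 0 ∨ n < j → w j = 0) ∧ ∀ j ∈ C.frozen, w j = 0 := by
  induction n generalizing w with
  | zero =>
    simp only [decisions, List.mem_singleton]
    refine ⟨fun h => by simp [h], fun h => funext fun j => h.1 j (by omega)⟩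
  | succ n ih =>
    simp only [decisions, List.mem_flatMap]
    constructor
    · rintro ⟨u, hu, hw⟩
      obtain ⟨b, rfl, hb⟩ := C.exists_of_mem_decisions_succ hw
      obtain ⟨h1, h2⟩ := ih.1 hu
      refine ⟨fun j hj => ?_, fun j hj => ?_⟩
      · rw [update_of_ne (by omega)]; exact h1 j (by omega)
      · by_cases hj' : j = n + 1
        · subst hj'; rw [update_self]; exact hb hj
        · rw [update_of_ne hj']; exact h2 j hj
    · rintro ⟨h1, h2⟩
      refine ⟨update w (n + 1) 0, ih.2 ⟨fun j hj => ?_, fun j hj => ?_⟩, ?_⟩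
      · by_cases hj' : j = n + 1
        · subst hj'; rw [update_self]
        · rw [update_of_ne hj']; exact h1 j (by omega)
      · by_cases hj' : j = n + 1
        · subst hj'; rw [update_self]
        · rw [update_of_ne hj']; exact h2 j hj
      · have hself : ∀ b, w (n + 1) = b → w = update w (n + 1) b := fun b hb => by
          rw [← hb, update_eq_self]
        simp only [update_idem]
        split_ifs with hf
        · exact List.mem_singleton.2 (hself 0 (h2 _ hf))
        · rcases zmod_two_cases (w (n + 1)) with hb | hb
          · exact List.mem_cons.2 (Or.inl (hself 0 hb))
          · exact List.mem_cons.2 (Or.inr (List.mem_singleton.2 (hself 1 hb)))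

theorem nodup_decisions (n : ℕ) : (C.decisions n).Nodup := by
  induction n with
  | zero => simp [decisions]
  | succ n ih =>
    rw [decisions, List.nodup_flatMap]
    constructor
    · intro u _
      split_ifs
      · simp
      · have : update u (n + 1) (0 : ZMod 2) ≠ update u (n + 1) 1 := fun h => by
          have := congrFun h (n + 1)
          simp at this
        simp [this]
    · refine List.Pairwise.imp_of_mem ?_ ih
      intro u u' hu hu' hne w hw hw'
      obtain ⟨b, hb, -⟩ := C.exists_of_mem_decisions_succ hw
      obtain ⟨b', hb', -⟩ := C.exists_of_mem_decisions_succ hw'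
      -- Undecided entries are still zero, so erasing entry `n + 1` recovers the parent, and
      -- different parents have no common continuation.
      have back : ∀ {u b}, u ∈ C.decisions n → w = update u (n + 1) b →
          u = update w (n + 1) 0 := fun {u b} hu hw => by
        rw [hw, update_idem, ← (C.mem_decisions.1 hu).1 (n + 1) (by omega), update_eq_self]
      exact hne ((back hu hb).trans (back hu' hb').symm)

/-- Node `(l, i)` decodes exactly the message bits after `lastLeaf d l (i - 1)` up to `lastLeaf d l
i`; the array operations do not touch `u`. -/
theorem map_u_decodeNode (d : ℕ) {l i : ℕ} (hm : l + d = m) (h1 : 1 ≤ i) {ps : List Path}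
    (hps : ps.map Path.u = C.decisions (C.lastLeaf d l (i - 1))) :
    (C.decodeNode ⊤ d l i ps).map Path.u = C.decisions (C.lastLeaf d l i) := by
  induction d generalizing l i ps with
  | zero =>
    obtain ⟨i, rfl⟩ : ∃ k, i = k + 1 := ⟨i - 1, by omega⟩
    simp only [lastLeaf, Nat.add_sub_cancel] at hps ⊢
    rw [decisions, ← hps, List.flatMap_map, decodeNode, decodeLeaf, prune_top, List.map_flatMap]
    congr 1
    funext p
    split_ifs <;> rfl
  | succ d ih =>
    have hmap : ∀ (f : Path → Path), (∀ p, (f p).u = p.u) → ∀ ps : List Path,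
        (ps.map f).map Path.u = ps.map Path.u := fun f hf ps => by
      rw [List.map_map]; exact List.map_congr_left fun p _ => hf p
    have first : (if 2 * (i - 1) ∉ C.I (l + 1) then
        (C.decodeNode ⊤ d (l + 1) (2 * i - 1) (ps.map (C.calcLeft l i (2 ^ d)))).map
          (saveFirst l (2 ^ d))
        else ps.map (restoreFirst l (2 ^ d))).map Path.u =
          C.decisions (C.lastLeaf d (l + 1) (2 * i - 1)) := by
      by_cases hI : 2 * (i - 1) ∈ C.I (l + 1)
      · rw [if_neg (not_not.2 hI), hmap (restoreFirst l _) (fun _ => rfl), hps, lastLeaf, C.lastChild_of_mem hI,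
          show 2 * (i - 1) + 1 = 2 * i - 1 by omega]
      · rw [if_pos hI, hmap (saveFirst l _) (fun _ => rfl)]
        refine ih (by omega) (by omega) ?_
        rw [hmap (C.calcLeft l i _) (fun _ => rfl), hps, lastLeaf_pred h1 hI]
    simp only [decodeNode]
    revert first
    generalize (if 2 * (i - 1) ∉ C.I (l + 1) then
        (C.decodeNode ⊤ d (l + 1) (2 * i - 1) (ps.map (C.calcLeft l i (2 ^ d)))).map
          (saveFirst l (2 ^ d))
        else ps.map (restoreFirst l (2 ^ d))) = ps₁
    intro first
    have second := ih (l := l + 1) (i := 2 * i) (ps := ps₁.map (C.calcMiddle l i (2 ^ d)))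
      (by omega) (by omega) (by rw [hmap (C.calcMiddle l i _) (fun _ => rfl), first])
    rw [lastLeaf]
    by_cases hI : 2 * i ∈ C.I (l + 1)
    · rw [if_neg (not_not.2 hI), hmap _ (C.combineThree_u l i _), C.lastChild_of_mem hI]
      refine ih (by omega) (by omega) ?_
      rw [hmap (C.calcRight l i _) (fun _ => rfl), hmap (saveSecond l _) (fun _ => rfl), second]
      rfl
    · rw [if_pos hI, hmap (combineTwo l _) (fun _ => rfl), second, C.lastChild_of_not_mem hI]

theorem lastLeaf_zero (d : ℕ) {l : ℕ} (hm : l + d = m) : C.lastLeaf d l 0 = 0 := by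
  induction d generalizing l with
  | zero => rfl
  | succ d ih =>
    rw [lastLeaf, C.lastChild_of_not_mem (C.zero_not_mem_I (by omega) (by omega))]
    exact ih (by omega)

theorem lastLeaf_pow (d : ℕ) {l : ℕ} (hm : l + d = m) : C.lastLeaf d l (2 ^ l) = 2 ^ m := by
  induction d generalizing l with
  | zero => obtain rfl : l = m := by omega
            rfl
  | succ d ih =>
    have hI : 2 * 2 ^ l ∉ C.I (l + 1) := fun h => by
      have := (C.pos_of_mem_I (by omega) (by omega) h).2
      rw [pow_succ] at this; omega
    rw [lastLeaf, C.lastChild_of_not_mem hI, ← pow_succ']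
    exact ih (by omega)

end Decisions

end Code

/-! ### Encoding -/

/-- A vector with positions counted from one, as a vector over `Fin n`. -/
def toVec (n : ℕ) (x : ℕ → ZMod 2) : Fin n → ZMod 2 := fun j => x (j + 1)

theorem vecMul_swapMatrix {n i : ℕ} (h1 : 1 ≤ i) (hi : i + 1 ≤ n) (x : ℕ → ZMod 2) :
    Matrix.vecMul (toVec n x) (swapMatrix n i) = toVec n fun k => x (Equiv.swap i (i + 1) k) := by
  funext c
  have hmem : 1 ≤ Equiv.swap i (i + 1) ((c : ℕ) + 1) ∧ Equiv.swap i (i + 1) ((c : ℕ) + 1) ≤ n := by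
    rw [Equiv.swap_apply_def]; have := c.2; split_ifs <;> omega
  -- The transposition is an involution, so the only row with a one in column `c` is the image of
  -- `c`, shifted back to counting from zero.
  rw [Matrix.vecMul, dotProduct, Finset.sum_eq_single
    ⟨Equiv.swap i (i + 1) ((c : ℕ) + 1) - 1, by omega⟩]
  · simp [swapMatrix, toVec, Nat.sub_add_cancel hmem.1]
  · intro r _ hr
    have : (c : ℕ) + 1 ≠ Equiv.swap i (i + 1) ((r : ℕ) + 1) := fun h => hr (Fin.ext (by
      simp [h]))
    simp [swapMatrix, this]
  · simp

theorem vecMul_addMatrix {n i : ℕ} (hi : i + 1 ≤ n) (x : ℕ → ZMod 2) :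
    Matrix.vecMul (toVec n x) (addMatrix n i) =
      toVec n fun k => if k = i then x k + x (k + 1) else x k := by
  funext c
  rw [Matrix.vecMul, dotProduct]
  by_cases hc : (c : ℕ) + 1 = i
  · subst hc
    have key : ∀ r : Fin n, toVec n x r * addMatrix n (c + 1) r c =
        (if r = c then x (c + 1) else 0) +
          if r = ⟨(c : ℕ) + 1, by omega⟩ then x (c + 1 + 1) else 0 := by
      intro r
      by_cases h1 : r = c
      · subst h1
        have : r ≠ ⟨(r : ℕ) + 1, by omega⟩ := fun h => by
          have := congrArg Fin.val h
          simp at this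
        simp [addMatrix, toVec, this]
      · by_cases h2 : (r : ℕ) = c + 1
        · have : r = ⟨(c : ℕ) + 1, by omega⟩ := Fin.ext h2
          simp [addMatrix, toVec, this, Fin.ext_iff]
        · have : r ≠ ⟨(c : ℕ) + 1, by omega⟩ := fun h => h2 (congrArg Fin.val h)
          simp [addMatrix, toVec, this, h1, h2]
    rw [Finset.sum_congr rfl fun r _ => key r, Finset.sum_add_distrib]
    simp [toVec]
  · rw [Finset.sum_eq_single c]
    · simp [addMatrix, toVec, hc]
    · intro r _ hr
      simp [addMatrix, hr, hc]
    · simp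

/-- The gap condition makes the transpositions disjoint, so at each position at most one factor acts
and their order is irrelevant. -/
theorem vecMul_prod_swapMatrix {n : ℕ} (L : List ℕ) (hn : L.Nodup)
    (hr : ∀ i ∈ L, 1 ≤ i ∧ i + 1 ≤ n) (hg : ∀ i ∈ L, ∀ j ∈ L, i < j → i + 4 ≤ j)
    (x : ℕ → ZMod 2) :
    Matrix.vecMul (toVec n x) (L.map (swapMatrix n)).prod =
      toVec n fun k => if k ∈ L then x (k + 1) else if k - 1 ∈ L then x (k - 1) else x k := by
  induction L generalizing x with
  | nil => simp
  | cons i L ih =>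
    obtain ⟨hiL, hn⟩ := List.nodup_cons.1 hn
    have hi := hr i (by simp)
    rw [List.map_cons, List.prod_cons, ← Matrix.vecMul_vecMul, vecMul_swapMatrix hi.1 hi.2,
      ih hn (fun j hj => hr j (by simp [hj])) fun j hj k hk => hg j (by simp [hj]) k (by simp [hk])]
    congr 1
    funext k
    have far : ∀ j ∈ L, j + 4 ≤ i ∨ i + 4 ≤ j := fun j hj => by
      rcases lt_trichotomy j i with h | h | h
      · exact Or.inl (hg j (by simp [hj]) i (by simp) h)
      · exact absurd (h ▸ hj) hiL
      · exact Or.inr (hg i (by simp) j (by simp [hj]) h)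
    simp only [List.mem_cons]
    by_cases hk : k ∈ L
    · have := far k hk
      simp only [hk, if_true, or_true]
      rw [Equiv.swap_apply_of_ne_of_ne (by omega) (by omega)]
    by_cases hk' : k - 1 ∈ L
    · have := far _ hk'
      simp only [hk, hk', if_true, or_true, or_false, if_false]
      rw [Equiv.swap_apply_of_ne_of_ne (by omega) (by omega), if_neg (by omega)]
    simp only [hk, hk', or_false, if_false]
    split_ifs with h1 h2
    · rw [h1, Equiv.swap_apply_left]
    · rw [show k = i + 1 by omega, Equiv.swap_apply_right, Nat.add_sub_cancel]
    · rw [Equiv.swap_apply_of_ne_of_ne h1 (by omega)]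

theorem vecMul_prod_addMatrix {n : ℕ} (L : List ℕ) (hn : L.Nodup)
    (hr : ∀ i ∈ L, i + 1 ≤ n) (hg : ∀ i ∈ L, ∀ j ∈ L, i < j → i + 4 ≤ j)
    (x : ℕ → ZMod 2) :
    Matrix.vecMul (toVec n x) (L.map (addMatrix n)).prod =
      toVec n fun k => if k ∈ L then x k + x (k + 1) else x k := by
  induction L generalizing x with
  | nil => simp
  | cons i L ih =>
    obtain ⟨hiL, hn⟩ := List.nodup_cons.1 hn
    rw [List.map_cons, List.prod_cons, ← Matrix.vecMul_vecMul, vecMul_addMatrix (hr i (by simp)),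
      ih hn (fun j hj => hr j (by simp [hj])) fun j hj k hk => hg j (by simp [hj]) k (by simp [hk])]
    congr 1
    funext k
    simp only [List.mem_cons]
    by_cases hk : k ∈ L
    · have h1 : k ≠ i := fun h => hiL (h ▸ hk)
      -- An entry being added is never itself a target, so every factor adds an original value.
      have h2 : k + 1 ≠ i := fun h => by
        have := hg k (by simp [hk]) i (by simp) (by omega)
        omega
      simp [hk, h1, h2]
    · simp [hk]

/-! ### The matrix recursion in coordinates -/

namespace Code

variable {m : ℕ}

theorem vecMul_Q (C : Code m) {l : ℕ} (h1 : 1 ≤ l) (hl : l ≤ m) (x : ℕ → ZMod 2) :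
    Matrix.vecMul (toVec (2 ^ l) x) (C.Q l) = toVec (2 ^ l) (C.mix l x) := by
  have hS : ∀ i ∈ C.S l, i ∈ C.I l := fun i hi => mem_I.2 (Or.inl hi)
  have hA : ∀ i ∈ C.A l, i ∈ C.I l := fun i hi => mem_I.2 (Or.inr hi)
  rw [Q, ← Matrix.vecMul_vecMul, vecMul_prod_swapMatrix _ (Finset.sort_nodup _ _)
      (fun i hi => C.pos_of_mem_I h1 hl (hS i ((Finset.mem_sort _).1 hi)))
      (fun i hi j hj => C.gap l h1 hl i (hS i ((Finset.mem_sort _).1 hi)) j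
        (hS j ((Finset.mem_sort _).1 hj))),
    vecMul_prod_addMatrix _ (Finset.sort_nodup _ _)
      (fun i hi => (C.pos_of_mem_I h1 hl (hA i ((Finset.mem_sort _).1 hi))).2)
      (fun i hi j hj => C.gap l h1 hl i (hA i ((Finset.mem_sort _).1 hi)) j
        (hA j ((Finset.mem_sort _).1 hj)))]
  congr 1
  funext k
  simp only [Finset.mem_sort, mix]
  by_cases hk : k ∈ C.A l
  · have hkS := C.not_mem_S_of_mem_A h1 hl hk
    have hk1 : k + 1 ∉ C.S l := fun h => C.add_one_not_mem_I h1 hl (hA k hk) (hS _ h)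
    have hpos := (C.pos_of_mem_I h1 hl (hA k hk)).1
    have hk' : k - 1 ∉ C.S l := fun h => C.add_one_not_mem_I h1 hl (hS _ h)
      (by rw [Nat.sub_add_cancel hpos]; exact hA k hk)
    simp [hk, hkS, hk1, hk']
  · simp [hk]

/-- The codeword of layer `l` that belongs to a vector. -/
def layerEncode (C : Code m) (l : ℕ) (x : ℕ → ZMod 2) : Fin (2 ^ l) → ZMod 2 :=
  Matrix.vecMul (toVec (2 ^ l) x) (C.G l)

theorem kronEquiv_val (l : ℕ) (k : Fin (2 ^ l)) (b : Fin 2) :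
    (kronEquiv l (k, b) : ℕ) = b + 2 * k := rfl

/-- The columns of the kernel are `(1, 1)` and `(0, 1)`, so codeword positions of index `(k, 0)`
encode the sums of the pairs and those of index `(k, 1)` their second entries. -/
theorem layerEncode_succ (C : Code m) {l : ℕ} (hl : l + 1 ≤ m) (x : ℕ → ZMod 2)
    (k : Fin (2 ^ l)) :
    C.layerEncode (l + 1) x (kronEquiv l (k, 0)) =
        C.layerEncode l (upper (C.mix (l + 1) x)) k ∧
      C.layerEncode (l + 1) x (kronEquiv l (k, 1)) =
        C.layerEncode l (lower (C.mix (l + 1) x)) k := by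
  have key : ∀ b : Fin 2, C.layerEncode (l + 1) x (kronEquiv l (k, b)) =
      ∑ k' : Fin (2 ^ l), ∑ b' : Fin 2, C.mix (l + 1) x ((kronEquiv l (k', b') : ℕ) + 1) *
        (C.G l k' k * arikanF b' b) := by
    intro b
    rw [layerEncode, G, ← Matrix.vecMul_vecMul, C.vecMul_Q (by omega) hl, Matrix.vecMul, dotProduct,
      ← (kronEquiv l).sum_comp, Fintype.sum_prod_type]
    simp [toVec, Matrix.kronecker]
  have e1 : ∀ k' : ℕ, 2 * (k' + 1) - 1 = 2 * k' + 1 := fun k' => by omega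
  have e2 : ∀ k' : ℕ, 1 + 2 * k' + 1 = 2 * (k' + 1) := fun k' => by omega
  rw [key, key]
  constructor
  · refine Finset.sum_congr rfl fun k' _ => ?_
    simp [kronEquiv_val, arikanF, toVec, upper, e1, e2, add_mul]
  · refine Finset.sum_congr rfl fun k' _ => ?_
    simp [kronEquiv_val, arikanF, toVec, lower, e2]

/-- Splitting a codeword position as `2 * k + b` gives `β + h * (2 * k + b) = (β + h * b) + (h * 2)
* k`, which is how `score` passes offset and stride to the components. -/
theorem score_eq_sum (C : Code m) (ω : ℕ → ZMod 2 → ℝ) {l : ℕ} (hl : l ≤ m) (h β : ℕ)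
    (x : ℕ → ZMod 2) :
    C.score ω l h β x = ∑ k : Fin (2 ^ l), ω (β + h * k) (C.layerEncode l x k) := by
  induction l generalizing h β x with
  | zero =>
    simp [score, layerEncode, G, toVec]
  | succ l ih =>
    rw [score, nodeScore, pairScore, ih (by omega), ih (by omega), ← (kronEquiv l).sum_comp,
      Fintype.sum_prod_type, ← Finset.sum_add_distrib]
    refine Finset.sum_congr rfl fun k _ => ?_
    rw [Fin.sum_univ_two, (C.layerEncode_succ hl x k).1, (C.layerEncode_succ hl x k).2,
      kronEquiv_val, kronEquiv_val]
    congr 2 <;> simp <;> ring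

/-- At every layer the blocks encode to interleaved parts of one codeword. At layer `0` the blocks
are single codeword bits, which gives `bit_zero_one`. -/
theorem layerEncode_bit (C : Code m) (d : ℕ) {l : ℕ} (hm : l + d = m) (u : ℕ → ZMod 2) {β : ℕ}
    (hβ : 1 ≤ β) (hβ' : β ≤ 2 ^ d) (k : Fin (2 ^ l)) (j : Fin (2 ^ m))
    (hj : (j : ℕ) = β - 1 + 2 ^ d * k) :
    C.layerEncode l (C.bit d l u β) k = C.layerEncode m u j := by
  induction d generalizing l β with
  | zero =>
    obtain rfl : l = m := by omega
    obtain rfl : β = 1 := by simp at hβ'; omega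
    have : j = k := Fin.ext (by simpa using hj)
    rw [this]; rfl
  | succ d ih =>
    rw [pow_succ] at hβ'
    simp only [bit]
    split_ifs with h
    · rw [← (C.layerEncode_succ (by omega) _ k).1]
      refine ih (by omega) hβ h _ ?_
      rw [hj, kronEquiv_val, pow_succ]; simp; ring
    · rw [← (C.layerEncode_succ (by omega) _ k).2]
      refine ih (by omega) (by omega) (by omega) _ ?_
      rw [hj, kronEquiv_val, pow_succ, Fin.val_one, mul_add, mul_one, ← mul_assoc]
      omega

theorem bit_zero_one (C : Code m) (u : ℕ → ZMod 2) (j : Fin (2 ^ m)) :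
    C.bit m 0 u (j + 1) 1 = C.layerEncode m u j := by
  rw [← C.layerEncode_bit m (zero_add m) u (β := j + 1) (by omega) j.2 0 j (by simp)]
  simp [layerEncode, G, toVec]

/-! ### The final paths -/

section Final

variable {Y : Type*} (C : Code m) (W : ZMod 2 → Y → ℝ) (y : Fin (2 ^ m) → Y)

/-- The logarithmic channel scores. -/
def logScore (W : ZMod 2 → Y → ℝ) (y : Fin (2 ^ m) → Y) (β : ℕ) (b : ZMod 2) : ℝ :=
  if hβ : 1 ≤ β ∧ β ≤ 2 ^ m then Real.log (W b (y ⟨β - 1, by omega⟩)) else 0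

theorem likelihood_pos (hW : ∀ x j, 0 < W x (y j)) (c : Fin (2 ^ m) → ZMod 2) :
    0 < likelihood W y c := Finset.prod_pos fun _ _ => hW _ _

theorem score_logScore (hW : ∀ x j, 0 < W x (y j)) (x : ℕ → ZMod 2) :
    C.score (logScore W y) m (2 ^ 0) 1 x = Real.log (likelihood W y (C.layerEncode m x)) := by
  rw [C.score_eq_sum _ le_rfl, likelihood, Real.log_prod fun j _ => (hW _ _).ne']
  refine Finset.sum_congr rfl fun k _ => ?_
  have hk : 1 ≤ 1 + 2 ^ 0 * (k : ℕ) ∧ 1 + 2 ^ 0 * (k : ℕ) ≤ 2 ^ m := by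
    have := k.2; omega
  rw [logScore, dif_pos hk]
  congr 3
  exact Fin.ext (by simp)

theorem best_logScore (hW : ∀ x j, 0 < W x (y j)) (x : ℕ → ZMod 2) :
    best (2 ^ m) (C.score (logScore W y) m (2 ^ 0) 1) 0 x =
      Real.log (Finset.univ.sup' Finset.univ_nonempty fun u => likelihood W y (C.encode u)) := by
  apply le_antisymm
  · obtain ⟨x', hx'⟩ := exists_best (2 ^ m) (C.score (logScore W y) m (2 ^ 0) 1) 0 x
    rw [hx', C.score_logScore W y hW]
    exact Real.log_le_log (likelihood_pos W y hW _) (Finset.le_sup'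
      (fun u => likelihood W y (C.encode u)) (Finset.mem_univ (toVec (2 ^ m) x')))
  · obtain ⟨u, -, hu⟩ := Finset.exists_mem_eq_sup' Finset.univ_nonempty
      fun u => likelihood W y (C.encode u)
    rw [hu]
    set x' : ℕ → ZMod 2 := fun k => if hk : k - 1 < 2 ^ m then u ⟨k - 1, hk⟩ else 0 with hx'
    have hvec : toVec (2 ^ m) x' = u := by
      funext j; simp [toVec, hx']
    have hle : C.score (logScore W y) m (2 ^ 0) 1 x' ≤ _ :=
      -- For the empty prefix every vector counts as an extension.
      le_best (C.localTo_score (logScore W y) le_rfl (2 ^ 0) 1) (j := 0) (x := x)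
        fun k h1 h2 => by omega
    rwa [C.score_logScore W y hW, layerEncode, hvec] at hle

theorem entry_initialPath (hW : ∀ x j, 0 < W x (y j)) :
    C.Entry (logScore W y) m 0 1 (initialPath W y) where
  L β hβ hβ' := by
    rw [llrAt, llr, best_of_le (by simp), best_of_le (by simp)]
    simp only [score, update_self, initialPath, logScore]
    rw [dif_pos ⟨trivial, hβ, hβ'⟩, dif_pos ⟨hβ, hβ'⟩, dif_pos ⟨hβ, hβ'⟩,
      Real.log_div (hW _ _).ne' (hW _ _).ne']
  -- The root is right-separated, since layer `0` has no entry after the first.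
  R hs := absurd (lt_of_not_rightSeparated hs) (by simp)
  leftover h := absurd h (by omega)
  metric := by
    rw [MetricCorrect, Nat.sub_self, C.lastLeaf_zero m (by omega), sub_self]; rfl

theorem exit_of_mem_finalPaths (hW : ∀ x j, 0 < W x (y j)) {q : Path}
    (hq : q ∈ C.finalPaths W y ⊤) :
    C.Exit (logScore W y) m 0 1 (initialPath W y) q := by
  obtain ⟨p, hp, h⟩ := C.exists_exit_of_mem_decodeNode (logScore W y) m (by omega) le_rfl (by simp)
    (fun p hp => by
      rw [List.mem_singleton.1 hp]; exact C.entry_initialPath W y hW) hq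
  rwa [List.mem_singleton.1 hp] at h

theorem codeword_of_mem_finalPaths (hW : ∀ x j, 0 < W x (y j)) {q : Path}
    (hq : q ∈ C.finalPaths W y ⊤) : q.codeword m = C.encode (q.message m) := by
  funext j
  exact ((C.exit_of_mem_finalPaths W y hW hq).B (j + 1) (by omega) j.2).trans (C.bit_zero_one q.u j)

theorem pm_of_mem_finalPaths (hW : ∀ x j, 0 < W x (y j)) {q : Path}
    (hq : q ∈ C.finalPaths W y ⊤) :
    q.pm = Real.log
      ((Finset.univ.sup' Finset.univ_nonempty fun u => likelihood W y (C.encode u)) /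
        likelihood W y (C.encode (q.message m))) := by
  have hleaf : C.lastLeaf m 0 1 = 2 ^ m := C.lastLeaf_pow m (by omega)
  have h := (C.exit_of_mem_finalPaths W y hW hq).metric
  rw [MetricCorrect, hleaf, best_of_le le_rfl, C.best_logScore W y hW,
    C.score_logScore W y hW] at h
  have hpos : 0 < Finset.univ.sup' Finset.univ_nonempty fun u => likelihood W y (C.encode u) :=
    (likelihood_pos W y hW (C.encode 0)).trans_le
      (Finset.le_sup' (fun u => likelihood W y (C.encode u)) (Finset.mem_univ 0))
  rw [Real.log_div hpos.ne' (likelihood_pos W y hW _).ne']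
  exact h

theorem map_u_finalPaths : (C.finalPaths W y ⊤).map Path.u = C.decisions (2 ^ m) := by
  rw [← C.lastLeaf_pow m (zero_add m)]
  refine C.map_u_decodeNode m (by omega) le_rfl ?_
  rw [Nat.sub_self, C.lastLeaf_zero m (by omega)]
  rfl

theorem map_message_finalPaths : (C.finalPaths W y ⊤).map (Path.message m) =
    (C.decisions (2 ^ m)).map (toVec (2 ^ m)) := by
  rw [← C.map_u_finalPaths W y, List.map_map]; rfl

theorem nodup_messages : ((C.finalPaths W y ⊤).map (Path.message m)).Nodup := by
  rw [C.map_message_finalPaths W y]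
  refine List.Nodup.map_on (fun u hu u' hu' h => funext fun j => ?_) (C.nodup_decisions _)
  by_cases hj : j = 0 ∨ 2 ^ m < j
  · rw [(C.mem_decisions.1 hu).1 j hj, (C.mem_decisions.1 hu').1 j hj]
  · have := congrFun h ⟨j - 1, by omega⟩
    simpa [toVec, show j - 1 + 1 = j by omega] using this

theorem exists_path_iff (u : Fin (2 ^ m) → ZMod 2) :
    (∃ p ∈ C.finalPaths W y ⊤, p.message m = u) ↔ C.IsMessage u := by
  rw [← List.mem_map, C.map_message_finalPaths W y, List.mem_map]
  constructor
  · rintro ⟨x, hx, rfl⟩ j hj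
    exact (C.mem_decisions.1 hx).2 _ hj
  · intro hu
    refine ⟨fun k => if hk : 1 ≤ k ∧ k ≤ 2 ^ m then u ⟨k - 1, by omega⟩ else 0,
      C.mem_decisions.2 ⟨fun j hj => dif_neg (by omega), fun j hj => ?_⟩, ?_⟩
    · have hr := C.frozen_range j hj
      rw [dif_pos hr]
      exact hu _ (by simpa [Nat.sub_add_cancel hr.1] using hj)
    · funext j
      have := j.2
      simp [toVec, show (j : ℕ) + 1 ≤ 2 ^ m from this]

/-- All metrics have the same numerator inside the logarithm, so comparing them reverses the
comparison of likelihoods, and the paths run through all messages. -/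
theorem isSCLOutput_iff (hW : ∀ x j, 0 < W x (y j)) (c : Fin (2 ^ m) → ZMod 2) :
    C.IsSCLOutput W y ⊤ c ↔ C.IsMLCodeword W y c := by
  have hpos : 0 < Finset.univ.sup' Finset.univ_nonempty fun u => likelihood W y (C.encode u) :=
    (likelihood_pos W y hW (C.encode 0)).trans_le
      (Finset.le_sup' (fun u => likelihood W y (C.encode u)) (Finset.mem_univ 0))
  have hlik := likelihood_pos W y hW
  have hpm : ∀ p ∈ C.finalPaths W y ⊤, ∀ q ∈ C.finalPaths W y ⊤, (p.pm ≤ q.pm ↔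
      likelihood W y (C.encode (q.message m)) ≤ likelihood W y (C.encode (p.message m))) := by
    intro p hp q hq
    rw [C.pm_of_mem_finalPaths W y hW hp, C.pm_of_mem_finalPaths W y hW hq,
      Real.log_le_log_iff (div_pos hpos (hlik _)) (div_pos hpos (hlik _)),
      div_le_div_iff_of_pos_left hpos (hlik _) (hlik _)]
  constructor
  · rintro ⟨p, hp, hmin, rfl⟩
    rw [C.codeword_of_mem_finalPaths W y hW hp]
    refine ⟨⟨_, (C.exists_path_iff W y _).1 ⟨p, hp, rfl⟩, rfl⟩, ?_⟩
    rintro c' ⟨u, hu, rfl⟩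
    obtain ⟨q, hq, rfl⟩ := (C.exists_path_iff W y u).2 hu
    exact (hpm p hp q hq).1 (hmin q hq)
  · rintro ⟨⟨u, hu, rfl⟩, hmax⟩
    obtain ⟨p, hp, rfl⟩ := (C.exists_path_iff W y u).2 hu
    refine ⟨p, hp, fun q hq => (hpm p hp q hq).2 (hmax _ ⟨_, ?_, rfl⟩),
      C.codeword_of_mem_finalPaths W y hW hp⟩
    exact (C.exists_path_iff W y _).1 ⟨q, hq, rfl⟩

theorem exists_isMLCodeword : ∃ c, C.IsMLCodeword W y c := by
  have hne : C.codewords.Nonempty := ⟨_, 0, fun _ _ => rfl, rfl⟩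
  obtain ⟨c, hc, hmax⟩ := Set.exists_max_image C.codewords (likelihood W y) (Set.toFinite _) hne
  exact ⟨c, hc, hmax⟩

end Final

end Code

end ABSPlus

end

theorem mainTheorem3 {Y : Type*} {m : ℕ} (C : ABSPlus.Code m) (W : ZMod 2 → Y → ℝ)
    (y : Fin (2 ^ m) → Y) (hW : ∀ x j, 0 < W x (y j)) :
    -- an output exists, and the possible outputs are precisely the maximum-likelihood codewords
    ((∃ c, C.IsSCLOutput W y ⊤ c) ∧
      ∀ c, C.IsSCLOutput W y ⊤ c ↔ C.IsMLCodeword W y c) ∧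
    -- the final paths correspond bijectively to the message vectors
    ((C.finalPaths W y ⊤).map (ABSPlus.Path.message m)).Nodup ∧
    (∀ u, (∃ p ∈ C.finalPaths W y ⊤, p.message m = u) ↔ C.IsMessage u) ∧
    -- codewords and metrics of the final paths
    ∀ p ∈ C.finalPaths W y ⊤,
      p.codeword m = C.encode (p.message m) ∧
      p.pm = Real.log
        ((Finset.univ.sup' Finset.univ_nonempty fun u => ABSPlus.likelihood W y (C.encode u)) /
          ABSPlus.likelihood W y (C.encode (p.message m))) := by
  obtain ⟨c, hc⟩ := C.exists_isMLCodeword W y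
  exact ⟨⟨⟨c, (C.isSCLOutput_iff W y hW c).2 hc⟩, C.isSCLOutput_iff W y hW⟩, C.nodup_messages W y,
    C.exists_path_iff W y, fun p hp => ⟨C.codeword_of_mem_finalPaths W y hW hp,
      C.pm_of_mem_finalPaths W y hW hp⟩⟩
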